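/- Let $G=\mathrm{PGL}(2,\mathbb R)$ act on $\mathbb{RP}^1$, let $G_0\subset G$ be the stabilizer of $[1:0]$, with Lie algebras $\mathfrak g_0\subset\mathfrak g=\mathfrak{sl}(2,\mathbb R)$. A projective connection on a connected smooth curve ($1$-manifold) $C$ is a principal right $G_0$-bundle $E\to C$ with a smooth $1$-form $\Omega$ on $E$ valued in $\mathfrak g$ such that (i) each $\Omega_e:T_eE\to\mathfrak g$ is a linear isomorphism, (ii) $r_g^*\Omega=\mathrm{Ad}_g^{-1}\Omega$ for $g\in G_0$, and (iii) for $A\in\mathfrak g_0$ the flow of the vector field $\vec A$ on $E$ defined by $\Omega(\vec A)=A$ is $r_{e^{tA}}$. It is complete if for every $A\in\mathfrak g$ the flow of $\vec A$ is defined for all time. The model is $G\to\mathbb{RP}^1$ with the Maurer--Cartan form $g^{-1}dg$. Let $\tilde C\to C$ be the universal covering, with the pulled back connection $\tilde E\to\tilde C$. A developing map is a map $\tilde C\to\mathbb{RP}^1$ covered by a $G_0$-equivariant map $\tilde E\to G$ that pulls back $g^{-1}dg$ to $\Omega$. Let $\widetilde{\mathbb{RP}}{}^1=\mathbb R\to\mathbb{RP}^1$,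 $\phi\mapsto[\cos\phi:\sin\phi]$, be the universal covering, with the pulled back connection; the affine coordinate is $x=\cot\phi$, and $x=\infty$ at $\phi\in\pi\mathbb Z$. For $m>0$, the affine map $x\mapsto mx+b$ is lifted to $\widetilde{\mathbb{RP}}{}^1$ so that it fixes all points $\phi\in\pi\mathbb Z$, and $x\mapsto mx+b+\infty_n$ denotes this lift followed by $\phi\mapsto\phi+n\pi$. Theorem. For a projective connection on a connected curve $C$, the following are equivalent. (a) The projective connection is complete. (b) The developing map identifies $\tilde C$ with $\widetilde{\mathbb{RP}}{}^1$, i.e. it lifts to a diffeomorphism $\tilde C\to\widetilde{\mathbb{RP}}{}^1$. (This holds for one developing map of $\tilde C$ if and only if it holds for each of them.) (c) The projective connection is isomorphic to one of the following: elliptic: $\widetilde{\mathbb{RP}}{}^1$, or $\widetilde{\mathbb{RP}}{}^1/(\phi\mapsto\phi+\theta)$ for some real $\theta\neq0$; closed parabolic of type (2): $\widetilde{\mathbb{RP}}{}^1/(x\mapsto x+1+\infty_n)$ for some integer $n\ne0$; closed hyperbolic of type (2): $\widetilde{\mathbb{RP}}{}^1/(x\mapsto rx+\infty_n)$ for some real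 $r>1$ and some integer $n\neq0$. -/

import Mathlib

open scoped Manifold ContDiff MatrixGroups LinearAlgebra.Projectivization
open Matrix LieAlgebra.SpecialLinear

universe u₁ u₂ u₃ u₄

noncomputable section

/-- The base point `[e₀] = [1 : 0]` of the real projective line. -/
def basePoint : ℙ ℝ (Fin 2 → ℝ) := Projectivization.mk ℝ ![1, 0] (by simp)

/-- The stabilizer of `[1 : 0]` in `PGL(2, ℝ)`.  A class in it has exactly one representative
`!![a, b; 0, 1]`, so the underlying smooth manifold is `ℝˣ × ℝ`, with coordinates `(a, b)`. -/
def StructureGroup : Type := ℝˣ × ℝ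

namespace StructureGroup

instance : TopologicalSpace StructureGroup := inferInstanceAs (TopologicalSpace (ℝˣ × ℝ))

instance : ChartedSpace (ModelProd ℝ ℝ) StructureGroup :=
  inferInstanceAs (ChartedSpace (ModelProd ℝ ℝ) (ℝˣ × ℝ))

instance : IsManifold (𝓘(ℝ, ℝ).prod 𝓘(ℝ, ℝ)) ∞ StructureGroup :=
  inferInstanceAs (IsManifold (𝓘(ℝ, ℝ).prod 𝓘(ℝ, ℝ)) ∞ (ℝˣ × ℝ))

/-- The group law is the product of the matrices `!![a, b; 0, 1]`. -/
instance : Group StructureGroup where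
  mul g h := (g.1 * h.1, g.1 * h.2 + g.2)
  one := (1, 0)
  inv g := (g.1⁻¹, -((g.1⁻¹ : ℝˣ) * g.2))
  mul_assoc g h k := by
    refine Prod.ext (mul_assoc _ _ _) ?_
    change ((g.1 * h.1 : ℝˣ) : ℝ) * k.2 + (g.1 * h.2 + g.2) = g.1 * (h.1 * k.2 + h.2) + g.2
    push_cast; ring
  one_mul g := by
    refine Prod.ext (one_mul _) ?_
    change ((1 : ℝˣ) : ℝ) * g.2 + 0 = g.2
    simp
  mul_one g := by
    refine Prod.ext (mul_one _) ?_
    change (g.1 : ℝ) * 0 + g.2 = g.2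
    simp
  inv_mul_cancel g := by
    refine Prod.ext (inv_mul_cancel _) ?_
    change ((g.1⁻¹ : ℝˣ) : ℝ) * g.2 + -((g.1⁻¹ : ℝˣ) * g.2) = 0
    ring

/-- The class of `!![a, b; 0, 1]`, acting on the affine coordinate of the projective line by
`x ↦ a * x + b`. -/
def affine (a : ℝˣ) (b : ℝ) : StructureGroup := (a, b)

/-- The representative `!![a, b; 0, 1]`. -/
def toMatrix (g : StructureGroup) : Matrix (Fin 2) (Fin 2) ℝ := !![(g.1 : ℝ), g.2; 0, 1]

@[simp] lemma mul_fst (g h : StructureGroup) : (g * h).1 = g.1 * h.1 := rfl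
@[simp] lemma mul_snd (g h : StructureGroup) : (g * h).2 = g.1 * h.2 + g.2 := rfl
@[simp] lemma one_fst : (1 : StructureGroup).1 = 1 := rfl
@[simp] lemma one_snd : (1 : StructureGroup).2 = 0 := rfl
@[simp] lemma inv_fst (g : StructureGroup) : (g⁻¹).1 = g.1⁻¹ := rfl
@[simp] lemma inv_snd (g : StructureGroup) : (g⁻¹).2 = -((g.1⁻¹ : ℝˣ) * g.2) := rfl

lemma toMatrix_mul (g h : StructureGroup) : (g * h).toMatrix = g.toMatrix * h.toMatrix := by
  ext i j; fin_cases i <;> fin_cases j <;> simp [toMatrix, Matrix.mul_apply, Fin.sum_univ_two]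

lemma toMatrix_one : (1 : StructureGroup).toMatrix = 1 := by
  ext i j; fin_cases i <;> fin_cases j <;> simp [toMatrix]

/-- The embedding in `GL(2, ℝ)`. -/
def toGL : StructureGroup →* GL (Fin 2) ℝ :=
  MonoidHom.toHomUnits ⟨⟨toMatrix, toMatrix_one⟩, toMatrix_mul⟩

@[simp] lemma coe_toGL (g : StructureGroup) :
    (toGL g : Matrix (Fin 2) (Fin 2) ℝ) = g.toMatrix := rfl

/-- The embedding in `PGL(2, ℝ)`. -/
def toPGL : StructureGroup →* PGL(2, ℝ) := ProjGenLinGroup.mk.comp toGL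

lemma toPGL_injective : Function.Injective toPGL := by
  intro g h hgh
  obtain ⟨u, hu⟩ := ProjGenLinGroup.mk_eq_mk_iff.1 hgh
  have H := fun i j => congrArg (fun x : GL (Fin 2) ℝ => (x : Matrix (Fin 2) (Fin 2) ℝ) i j) hu
  have h11 := H 1 1
  have h00 := H 0 0
  have h01 := H 0 1
  simp [toMatrix, Matrix.mul_apply, Fin.sum_univ_two] at h11 h00 h01
  simp [h11] at h00 h01
  exact Prod.ext (Units.ext h00) h01

lemma range_toPGL : toPGL.range = MulAction.stabilizer PGL(2, ℝ) basePoint := by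
  ext x
  induction x using ProjGenLinGroup.induction_on with | mk m =>
  rw [MulAction.mem_stabilizer_iff, basePoint, Projectivization.PGL.mk_smul_mk,
    Projectivization.mk_eq_mk_iff']
  constructor
  · rintro ⟨g, hg⟩
    obtain ⟨u, hu⟩ := ProjGenLinGroup.mk_eq_mk_iff.1 hg
    refine ⟨g.1 * u, ?_⟩
    rw [← hu]
    ext i; fin_cases i <;> simp [toMatrix, Matrix.mul_apply, Fin.sum_univ_two]
  · rintro ⟨c, hc⟩
    have h10 : m 1 0 = 0 := by simpa using (congrFun hc 1).symm
    have hdet : m 0 0 * m 1 1 ≠ 0 := by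
      have := m.det.ne_zero
      simpa [Matrix.det_fin_two, h10] using this
    have h00 := left_ne_zero_of_mul hdet
    have h11 := right_ne_zero_of_mul hdet
    let g : StructureGroup := (Units.mk0 (m 0 0 / m 1 1) (div_ne_zero h00 h11), m 0 1 / m 1 1)
    have hg : (toGL g : Matrix (Fin 2) (Fin 2) ℝ) = !![m 0 0 / m 1 1, m 0 1 / m 1 1; 0, 1] := rfl
    refine ⟨g, ProjGenLinGroup.mk_eq_mk_iff.2 ⟨Units.mk0 _ h11, ?_⟩⟩
    ext i j; fin_cases i <;> fin_cases j <;> simp [hg, h11, h10]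

end StructureGroup

/-- The class in `PGL(2, ℝ)` of the exponential of a matrix. -/
def expPGL (A : Matrix (Fin 2) (Fin 2) ℝ) : PGL(2, ℝ) :=
  ProjGenLinGroup.mk (Matrix.isUnit_exp A).unit

lemma StructureGroup.exists_toPGL_eq_expPGL {A : Matrix (Fin 2) (Fin 2) ℝ} (hA : A 1 0 = 0) :
    ∃ g : StructureGroup, g.toPGL = expPGL A := by
  have h10 : NormedSpace.exp A 1 0 = 0 := by
    have : A.BlockTriangular id := by
      intro i j hij
      fin_cases i <;> fin_cases j <;> simp_all
    exact this.exp (by simp : (0 : Fin 2) < 1)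
  have : expPGL A ∈ StructureGroup.toPGL.range := by
    rw [StructureGroup.range_toPGL, MulAction.mem_stabilizer_iff, basePoint, expPGL,
      Projectivization.PGL.mk_smul_mk, Projectivization.mk_eq_mk_iff']
    refine ⟨NormedSpace.exp A 0 0, ?_⟩
    ext i; fin_cases i <;> simp [h10]
  exact this

/-- `StructureGroup.exp A` is the element `e ^ A` of the structure group, for `A` in its Lie
algebra, that is for `A 1 0 = 0` (and `1` for other `A`). -/
def StructureGroup.exp (A : Matrix (Fin 2) (Fin 2) ℝ) : StructureGroup :=
  open scoped Classical in if hA : A 1 0 = 0 then (exists_toPGL_eq_expPGL hA).choose else 1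

lemma StructureGroup.toPGL_exp {A : Matrix (Fin 2) (Fin 2) ℝ} (hA : A 1 0 = 0) :
    (StructureGroup.exp A).toPGL = expPGL A := by
  rw [StructureGroup.exp, dif_pos hA]
  exact (exists_toPGL_eq_expPGL hA).choose_spec

/-- Total spaces are smooth 3-manifolds, modelled on `ℝ × ℝ × ℝ`. -/
abbrev Model3 : Type := ModelProd ℝ (ModelProd ℝ ℝ)

/-- The model with corners (without boundary) of 3-manifolds. -/
abbrev I3 : ModelWithCorners ℝ (ℝ × ℝ × ℝ) Model3 := 𝓘(ℝ, ℝ).prod (𝓘(ℝ, ℝ).prod 𝓘(ℝ, ℝ))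

/-- A projective connection on the curve `C`: a principal right bundle `E → C` for the stabilizer
of `[1 : 0]` in `PGL(2, ℝ)`, with a smooth 1-form `Ω` on `E` valued in `sl(2, ℝ)`. -/
structure ProjectiveConnection (E : Type*) [TopologicalSpace E] [ChartedSpace Model3 E]
    [IsManifold I3 ∞ E] (C : Type*) [TopologicalSpace C] [ChartedSpace ℝ C] where
  /-- the bundle projection -/
  proj : E → C
  /-- the right action of the structure group -/
  act : E → StructureGroup → E
  act_one : ∀ e, act e 1 = e
  act_mul : ∀ e g h, act e (g * h) = act (act e g) h
  contMDiff_proj : ContMDiff I3 𝓘(ℝ, ℝ) ∞ proj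
  contMDiff_act : ContMDiff (I3.prod (𝓘(ℝ, ℝ).prod 𝓘(ℝ, ℝ))) I3 ∞
    (fun p : E × StructureGroup => act p.1 p.2)
  /-- Local triviality: over an open set `U`, the map `(x, g) ↦ σ x · g` is an equivariant
  diffeomorphism from `U × StructureGroup` onto `proj ⁻¹' U`, with inverse `(proj, τ)`. -/
  locally_trivial : ∀ c : C, ∃ U : Set C, IsOpen U ∧ c ∈ U ∧
    ∃ (σ : C → E) (τ : E → StructureGroup),
      ContMDiffOn 𝓘(ℝ, ℝ) I3 ∞ σ U ∧
      ContMDiffOn I3 (𝓘(ℝ, ℝ).prod 𝓘(ℝ, ℝ)) ∞ τ (proj ⁻¹' U) ∧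
      (∀ x ∈ U, ∀ g, proj (act (σ x) g) = x ∧ τ (act (σ x) g) = g) ∧
      ∀ e ∈ proj ⁻¹' U, act (σ (proj e)) (τ e) = e
  /-- the connection form, a linear isomorphism at each point -/
  Ω : ∀ e : E, TangentSpace I3 e ≃ₗ[ℝ] sl (Fin 2) ℝ
  contMDiff_Ω : ∀ i j, ContMDiff I3.tangent 𝓘(ℝ, ℝ) ∞
    (fun v : TangentBundle I3 E => (Ω v.1 v.2 : Matrix (Fin 2) (Fin 2) ℝ) i j)
  /-- `r_g^* Ω = Ad(g)⁻¹ Ω` -/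
  equivariant : ∀ g e (v : TangentSpace I3 e),
    (Ω (act e g) (mfderiv I3 I3 (fun x => act x g) e v) : Matrix (Fin 2) (Fin 2) ℝ) =
      g.toMatrix⁻¹ * (Ω e v : Matrix (Fin 2) (Fin 2) ℝ) * g.toMatrix
  /-- For `A` in the Lie algebra of the structure group, the flow of the vector field `Ω⁻¹ A` is
  the right action of `e ^ (t A)`. -/
  flow : ∀ A : sl (Fin 2) ℝ, (A : Matrix (Fin 2) (Fin 2) ℝ) 1 0 = 0 → ∀ e : E,
    IsMIntegralCurve (I := I3)
      (fun t : ℝ => act e (StructureGroup.exp (t • (A : Matrix (Fin 2) (Fin 2) ℝ))))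
      (fun x => (Ω x).symm A)

/-! ### The universal cover of the projective line -/

/-- The total space of the bundle over the universal cover `ℝ` of the projective line: the point
`(φ, g)` stands for the element `rot φ * g` of the universal cover of `PGL(2, ℝ)`. -/
abbrev UCBundle : Type := ℝ × StructureGroup

namespace UCBundle

lemma contMDiff_fst_coord : ContMDiff I3 𝓘(ℝ, ℝ) ∞ (fun e : UCBundle => e.1) := contMDiff_fst

lemma contMDiff_a : ContMDiff I3 𝓘(ℝ, ℝ) ∞ (fun e : UCBundle => (e.2.1 : ℝ)) :=
  (Units.contMDiff_val (R := ℝ)).comp (contMDiff_fst (M := ℝˣ) (N := ℝ)|>.comp contMDiff_snd)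

lemma contMDiff_b : ContMDiff I3 𝓘(ℝ, ℝ) ∞ (fun e : UCBundle => e.2.2) :=
  (contMDiff_snd (M := ℝˣ) (N := ℝ)).comp contMDiff_snd

section
variable {V H N : Type*} [NormedAddCommGroup V] [NormedSpace ℝ V] [TopologicalSpace H]
  {I : ModelWithCorners ℝ V H} [TopologicalSpace N] [ChartedSpace H N]

lemma contMDiffOn_structureGroup {f : N → StructureGroup} {s : Set N}
    (ha : ContMDiffOn I 𝓘(ℝ, ℝ) ∞ (fun x => ((f x).1 : ℝ)) s)
    (hb : ContMDiffOn I 𝓘(ℝ, ℝ) ∞ (fun x => (f x).2) s) :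
    ContMDiffOn I (𝓘(ℝ, ℝ).prod 𝓘(ℝ, ℝ)) ∞ f s := by
  have ha' : ContMDiffOn I 𝓘(ℝ, ℝ) ∞ (fun x => (f x).1) s := by
    intro x hx
    have h := ha x hx
    rw [contMDiffWithinAt_iff] at h ⊢
    exact ⟨Units.isOpenEmbedding_val.isInducing.continuousWithinAt_iff.2 h.1, h.2⟩
  exact ha'.prodMk hb

lemma hasMFDerivAt_units {f : N → ℝˣ} {x : N} {f' : TangentSpace I x →L[ℝ] ℝ}
    (h : HasMFDerivAt I 𝓘(ℝ, ℝ) (fun y => (f y : ℝ)) x f') :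
    HasMFDerivAt I 𝓘(ℝ, ℝ) f x f' :=
  ⟨Units.isOpenEmbedding_val.isInducing.continuousAt_iff.2 h.1, h.2⟩

lemma hasMFDerivAt_mk {f : N → UCBundle} {x : N} {f1 f2 f3 : TangentSpace I x →L[ℝ] ℝ}
    (h1 : HasMFDerivAt I 𝓘(ℝ, ℝ) (fun y => (f y).1) x f1)
    (h2 : HasMFDerivAt I 𝓘(ℝ, ℝ) (fun y => ((f y).2.1 : ℝ)) x f2)
    (h3 : HasMFDerivAt I 𝓘(ℝ, ℝ) (fun y => (f y).2.2) x f3) :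
    HasMFDerivAt I I3 f x (f1.prod (f2.prod f3)) :=
  h1.prodMk ((hasMFDerivAt_units h2).prodMk h3)

end

lemma hasMFDerivAt_val (u : ℝˣ) : HasMFDerivAt 𝓘(ℝ, ℝ) 𝓘(ℝ, ℝ) (fun u : ℝˣ => (u : ℝ)) u
    (ContinuousLinearMap.id ℝ ℝ) :=
  have h0 : HasMFDerivAt 𝓘(ℝ, ℝ) 𝓘(ℝ, ℝ) (fun u : ℝˣ => u) u
      (ContinuousLinearMap.id ℝ ℝ) := hasMFDerivAt_id u
  ⟨Units.continuous_val.continuousAt, h0.2⟩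

lemma hasMFDerivAt_a (e : UCBundle) : HasMFDerivAt I3 𝓘(ℝ, ℝ) (fun e : UCBundle => (e.2.1 : ℝ)) e
    ((ContinuousLinearMap.fst ℝ ℝ ℝ).comp (ContinuousLinearMap.snd ℝ ℝ (ℝ × ℝ))) := by
  have h2 : HasMFDerivAt I3 𝓘(ℝ, ℝ) (fun e : UCBundle => e.2.1) e
      ((ContinuousLinearMap.fst ℝ ℝ ℝ).comp (ContinuousLinearMap.snd ℝ ℝ (ℝ × ℝ))) :=
    (hasMFDerivAt_fst (M := ℝˣ) (M' := ℝ) e.2).comp e (hasMFDerivAt_snd (M := ℝ) (M' := ℝˣ × ℝ) e)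
  have h3 := HasMFDerivAt.comp (g := fun u : ℝˣ => (u : ℝ)) e (hasMFDerivAt_val e.2.1) h2
  exact h3

lemma hasMFDerivAt_b (e : UCBundle) : HasMFDerivAt I3 𝓘(ℝ, ℝ) (fun e : UCBundle => e.2.2) e
    ((ContinuousLinearMap.snd ℝ ℝ ℝ).comp (ContinuousLinearMap.snd ℝ ℝ (ℝ × ℝ))) :=
  (hasMFDerivAt_snd (M := ℝˣ) (M' := ℝ) e.2).comp e (hasMFDerivAt_snd (M := ℝ) (M' := ℝˣ × ℝ) e)

/-- At `(φ, g)` with `g = !![a, b; 0, 1]`, on the tangent vector `v = (dφ, da, db)`, the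
Maurer–Cartan form of `PGL(2, ℝ)` along `rot φ * g`: see `form_eq`. -/
def form (e : UCBundle) : (ℝ × ℝ × ℝ) ≃ₗ[ℝ] sl (Fin 2) ℝ where
  toFun v := ⟨!![-(e.2.2 * v.1) + v.2.1 / (2 * e.2.1), (v.2.2 - (1 + e.2.2 ^ 2) * v.1) / e.2.1;
      e.2.1 * v.1, e.2.2 * v.1 - v.2.1 / (2 * e.2.1)], by
    simp [sl, Matrix.trace_fin_two]⟩
  map_add' v w := by
    ext i j
    fin_cases i <;> fin_cases j <;> simp <;> ring
  map_smul' c v := by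
    ext i j
    fin_cases i <;> fin_cases j <;> simp <;> ring
  invFun A := (A.1 1 0 / e.2.1, 2 * e.2.1 * (A.1 0 0 + e.2.2 * (A.1 1 0 / e.2.1)),
    e.2.1 * A.1 0 1 + (1 + e.2.2 ^ 2) * (A.1 1 0 / e.2.1))
  left_inv v := by
    have := e.2.1.ne_zero
    refine Prod.ext ?_ (Prod.ext ?_ ?_) <;> simp <;> field_simp <;> ring
  right_inv A := by
    have := e.2.1.ne_zero
    have ht : A.1 0 0 + A.1 1 1 = 0 := by
      have h : Matrix.trace A.1 = 0 := A.2
      rwa [Matrix.trace_fin_two] at h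
    ext i j
    fin_cases i <;> fin_cases j <;> simp <;> field_simp <;> first | ring1 | linarith

/-- `form e v` is the class of `m⁻¹ dm` modulo scalar matrices, where `m = rot φ * g`, `rot φ` is
the rotation of angle `φ` and `rot⁻¹ d(rot) = !![0, -1; 1, 0] dφ`. -/
lemma form_eq (e : UCBundle) (v : ℝ × ℝ × ℝ) :
    (form e v : Matrix (Fin 2) (Fin 2) ℝ) + (v.2.1 / (2 * e.2.1)) • 1 =
      e.2.toMatrix⁻¹ * (v.1 • !![0, -1; 1, 0]) * e.2.toMatrix +
        e.2.toMatrix⁻¹ * !![v.2.1, v.2.2; 0, 0] := by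
  have := e.2.1.ne_zero
  ext i j
  fin_cases i <;> fin_cases j <;>
    simp [form, StructureGroup.toMatrix, Matrix.inv_def, Matrix.det_fin_two, Matrix.adjugate_fin_two] <;> field_simp <;> ring

end UCBundle

lemma StructureGroup.exp_coords {A : Matrix (Fin 2) (Fin 2) ℝ} (hA : A 1 0 = 0) :
    NormedSpace.exp A 1 1 ≠ 0 ∧ NormedSpace.exp A 1 0 = 0 ∧
    ((exp A).1 : ℝ) = NormedSpace.exp A 0 0 / NormedSpace.exp A 1 1 ∧
    (exp A).2 = NormedSpace.exp A 0 1 / NormedSpace.exp A 1 1 := by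
  obtain ⟨u, hu⟩ := ProjGenLinGroup.mk_eq_mk_iff.1 (toPGL_exp hA)
  have H := fun i j => congrArg (fun x : GL (Fin 2) ℝ => (x : Matrix (Fin 2) (Fin 2) ℝ) i j) hu
  have h11 := H 1 1
  have h10 := H 1 0
  have h00 := H 0 0
  have h01 := H 0 1
  simp [toMatrix, Matrix.mul_apply, Fin.sum_univ_two] at h11 h00 h01 h10
  rw [← h11, ← h10, ← h00, ← h01]
  have := u.ne_zero
  simp

lemma hasDerivAt_matrix_exp (A : Matrix (Fin 2) (Fin 2) ℝ) (t : ℝ) (i j : Fin 2) :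
    HasDerivAt (fun s : ℝ => NormedSpace.exp (s • A) i j)
      ((NormedSpace.exp (t • A) * A) i j) t := by
  have h := open scoped Matrix.Norms.Operator in hasDerivAt_exp_smul_const (𝕂 := ℝ) A t
  open scoped Matrix.Norms.Operator in
  exact hasDerivAt_pi.1 (hasDerivAt_pi.1 h i) j

namespace UCBundle

lemma form_apply00 (e : UCBundle) (v : ℝ × ℝ × ℝ) : (form e v : Matrix (Fin 2) (Fin 2) ℝ) 0 0 =
    -(e.2.2 * v.1) + v.2.1 / (2 * e.2.1) := rfl

lemma form_apply01 (e : UCBundle) (v : ℝ × ℝ × ℝ) : (form e v : Matrix (Fin 2) (Fin 2) ℝ) 0 1 =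
    (v.2.2 - (1 + e.2.2 ^ 2) * v.1) / e.2.1 := rfl

lemma form_apply11 (e : UCBundle) (v : ℝ × ℝ × ℝ) : (form e v : Matrix (Fin 2) (Fin 2) ℝ) 1 1 =
    e.2.2 * v.1 - v.2.1 / (2 * e.2.1) := rfl

lemma form_symm_apply (e : UCBundle) {A : sl (Fin 2) ℝ}
    (hA : (A : Matrix (Fin 2) (Fin 2) ℝ) 1 0 = 0) :
    (form e).symm A = (0, 2 * e.2.1 * A.1 0 0, e.2.1 * A.1 0 1) := by
  refine Prod.ext ?_ (Prod.ext ?_ ?_) <;> simp [form, hA]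

lemma mfderiv_act (g : StructureGroup) (e : UCBundle) (v : ℝ × ℝ × ℝ) :
    mfderiv I3 I3 (fun x : UCBundle => ((x.1, x.2 * g) : UCBundle)) e v =
      (v.1, v.2.1 * g.1, v.2.1 * g.2 + v.2.2) := by
  have ha := hasMFDerivAt_a e
  have hb := hasMFDerivAt_b e
  have h1 : HasMFDerivAt I3 𝓘(ℝ, ℝ) (fun e : UCBundle => e.1) e _ :=
    hasMFDerivAt_fst (M := ℝ) (M' := ℝˣ × ℝ) e
  have hm (c : ℝ) : HasMFDerivAt 𝓘(ℝ, ℝ) 𝓘(ℝ, ℝ) (fun r : ℝ => r * c) (e.2.1 : ℝ) _ :=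
    ((hasFDerivAt_id (𝕜 := ℝ) (e.2.1 : ℝ)).mul_const c).hasMFDerivAt
  have h2 := (hm g.1).comp e ha
  have h3 := ((hm g.2).comp e ha).add hb
  have h := (hasMFDerivAt_mk (f := fun x : UCBundle => ((x.1, x.2 * g) : UCBundle)) h1 h2 h3).mfderiv
  rw [h]
  refine Prod.ext rfl (Prod.ext ?_ ?_)
  · exact mul_comm _ _
  · exact congrArg (· + v.2.2) (mul_comm _ _)

lemma form_act (g : StructureGroup) (e : UCBundle) (v : ℝ × ℝ × ℝ) :
    (form (e.1, e.2 * g) (v.1, v.2.1 * g.1, v.2.1 * g.2 + v.2.2) : Matrix (Fin 2) (Fin 2) ℝ) =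
      g.toMatrix⁻¹ * (form e v : Matrix (Fin 2) (Fin 2) ℝ) * g.toMatrix := by
  have := e.2.1.ne_zero
  have := g.1.ne_zero
  ext i j
  fin_cases i <;> fin_cases j <;>
    simp [form, StructureGroup.toMatrix, Matrix.inv_def, Matrix.det_fin_two,
      Matrix.adjugate_fin_two] <;> field_simp <;> ring

lemma flow {A : sl (Fin 2) ℝ} (hA : (A : Matrix (Fin 2) (Fin 2) ℝ) 1 0 = 0) (e : UCBundle)
    (t : ℝ) : HasMFDerivAt 𝓘(ℝ, ℝ) I3
      (fun t : ℝ => ((e.1, e.2 * StructureGroup.exp (t • (A : Matrix (Fin 2) (Fin 2) ℝ))) :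
        UCBundle)) t
      ((1 : ℝ →L[ℝ] ℝ).smulRight ((form (e.1, e.2 * StructureGroup.exp
        (t • (A : Matrix (Fin 2) (Fin 2) ℝ)))).symm A)) := by
  have hc (s : ℝ) := StructureGroup.exp_coords
    (A := s • (A : Matrix (Fin 2) (Fin 2) ℝ)) (by simp [hA])
  have hd := hasDerivAt_matrix_exp (A : Matrix (Fin 2) (Fin 2) ℝ) t
  have htr : A.1 1 1 = - A.1 0 0 := by
    have h : Matrix.trace A.1 = 0 := A.2
    rw [Matrix.trace_fin_two] at h
    linarith
  have ha := (hd 0 0).div (hd 1 1) (hc t).1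
  have hb := (hd 0 1).div (hd 1 1) (hc t).1
  have h1 : HasMFDerivAt 𝓘(ℝ, ℝ) 𝓘(ℝ, ℝ) (fun _ : ℝ => e.1) t _ :=
    hasMFDerivAt_const e.1 t
  have h2 := (ha.const_mul (e.2.1 : ℝ)).hasFDerivAt.hasMFDerivAt
  have h3 := ((hb.const_mul (e.2.1 : ℝ)).add_const e.2.2).hasFDerivAt.hasMFDerivAt
  have h := hasMFDerivAt_mk
    (f := fun t : ℝ => ((e.1, e.2 * StructureGroup.exp (t • (A : Matrix (Fin 2) (Fin 2) ℝ))) :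
        UCBundle)) h1 (h2.congr_of_eventuallyEq (.of_forall fun s => by simp [(hc s).2.2.1]))
      (h3.congr_of_eventuallyEq (.of_forall fun s => by simp [(hc s).2.2.2]))
  refine h.congr_mfderiv (ContinuousLinearMap.ext fun (r : ℝ) => ?_)
  obtain ⟨h11, h10, ea, eb⟩ := hc t
  have := e.2.1.ne_zero
  have m00 := (form_symm_apply (e.1, e.2 * StructureGroup.exp
        (t • (A : Matrix (Fin 2) (Fin 2) ℝ))) hA)
  rw [StructureGroup.mul_fst] at m00
  refine Prod.ext ?_ (Prod.ext ?_ ?_)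
  · change (0 : ℝ) = r * _
    rw [m00]; simp
  · change r * _ = r * _
    rw [m00]
    simp [Matrix.mul_apply, Fin.sum_univ_two, hA, htr, ea, h10]
    left
    field_simp
    ring
  · change r * _ = r * _
    rw [m00]
    simp [Matrix.mul_apply, Fin.sum_univ_two, htr, ea, h10]
    left
    field_simp
    ring

end UCBundle

/-- The projective connection on the universal cover `ℝ` of the projective line: the pullback of
the model `PGL(2, ℝ) → ℙ¹`, with its Maurer–Cartan form, by `φ ↦ [cos φ : sin φ]`. -/
def ucModel : ProjectiveConnection UCBundle ℝ where
  proj e := e.1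
  act e g := (e.1, e.2 * g)
  act_one e := by simp
  act_mul e g h := by simp [mul_assoc]
  contMDiff_proj := contMDiff_fst
  contMDiff_act := by
    rw [← contMDiffOn_univ]
    have h1 : ContMDiff (I3.prod (𝓘(ℝ, ℝ).prod 𝓘(ℝ, ℝ))) I3 ∞
      (fun p : UCBundle × StructureGroup => p.1) := contMDiff_fst
    have h2 : ContMDiff (I3.prod (𝓘(ℝ, ℝ).prod 𝓘(ℝ, ℝ))) (𝓘(ℝ, ℝ).prod 𝓘(ℝ, ℝ)) ∞
      (fun p : UCBundle × StructureGroup => p.2) := contMDiff_snd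
    have ha := UCBundle.contMDiff_a.comp h1
    have hb := UCBundle.contMDiff_b.comp h1
    have ha2 := ((Units.contMDiff_val (R := ℝ)).comp (contMDiff_fst (M := ℝˣ) (N := ℝ))).comp h2
    have hb2 := (contMDiff_snd (M := ℝˣ) (N := ℝ)).comp h2
    refine ((UCBundle.contMDiff_fst_coord.comp h1).contMDiffOn).prodMk
      (UCBundle.contMDiffOn_structureGroup ?_ ?_)
    · exact (ha.mul ha2).contMDiffOn
    · exact ((ha.mul hb2).add hb).contMDiffOn
  locally_trivial c := by
    refine ⟨Set.univ, isOpen_univ, trivial, fun x => (x, 1), fun e => e.2, ?_, ?_, ?_, ?_⟩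
    · exact (contMDiff_id.prodMk contMDiff_const).contMDiffOn
    · exact contMDiff_snd.contMDiffOn
    · intro x _ g; simp
    · intro e _; simp
  Ω := UCBundle.form
  contMDiff_Ω := by
    have key : ∀ f : UCBundle → ℝ, ContMDiff I3 𝓘(ℝ, ℝ) ∞ f →
        ContMDiff I3.tangent 𝓘(ℝ, ℝ) ∞
          (fun v : TangentBundle I3 UCBundle => mfderiv I3 𝓘(ℝ, ℝ) f v.1 v.2) := fun f hf =>
      (contMDiff_snd_tangentBundle_modelSpace ℝ 𝓘(ℝ, ℝ)).comp
        (hf.contMDiff_tangentMap (m := ∞) (by simp))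
    have base : ∀ f : UCBundle → ℝ, ContMDiff I3 𝓘(ℝ, ℝ) ∞ f →
        ContMDiff I3.tangent 𝓘(ℝ, ℝ) ∞ (fun v : TangentBundle I3 UCBundle => f v.1) := fun f hf =>
      hf.comp (Bundle.contMDiff_proj _)
    have d1 : ContMDiff I3.tangent 𝓘(ℝ, ℝ) ∞ (fun v : TangentBundle I3 UCBundle =>
        ((v.2 : ℝ × ℝ × ℝ).1 : ℝ)) := by
      refine (key _ UCBundle.contMDiff_fst_coord).congr fun v => ?_
      have h : mfderiv I3 𝓘(ℝ, ℝ) (fun e : UCBundle => e.1) v.1 = _ :=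
        (hasMFDerivAt_fst (M := ℝ) (M' := ℝˣ × ℝ) v.1).mfderiv
      rw [h]; rfl
    have d2 : ContMDiff I3.tangent 𝓘(ℝ, ℝ) ∞ (fun v : TangentBundle I3 UCBundle =>
        ((v.2 : ℝ × ℝ × ℝ).2.1 : ℝ)) := by
      refine (key _ UCBundle.contMDiff_a).congr fun v => ?_
      rw [(UCBundle.hasMFDerivAt_a v.1).mfderiv]; rfl
    have d3 : ContMDiff I3.tangent 𝓘(ℝ, ℝ) ∞ (fun v : TangentBundle I3 UCBundle =>
        ((v.2 : ℝ × ℝ × ℝ).2.2 : ℝ)) := by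
      refine (key _ UCBundle.contMDiff_b).congr fun v => ?_
      rw [(UCBundle.hasMFDerivAt_b v.1).mfderiv]; rfl
    have a := base _ UCBundle.contMDiff_a
    have b := base _ UCBundle.contMDiff_b
    have ai : ContMDiff I3.tangent 𝓘(ℝ, ℝ) ∞ (fun v : TangentBundle I3 UCBundle =>
        ((v.1.2.1 : ℝ))⁻¹) := by
      intro v
      exact (contDiffAt_inv ℝ v.1.2.1.ne_zero).contMDiffAt.comp v (a v)
    intro i j
    fin_cases i <;> fin_cases j
    · exact ((b.mul d1).neg.add ((contMDiff_const (c := (2 : ℝ)⁻¹)).mul (d2.mul ai))).congr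
        fun v => (UCBundle.form_apply00 v.1 v.2).trans (by simp; ring)
    · exact ((d3.sub ((contMDiff_const (c := (1 : ℝ)).add (b.mul b)).mul d1)).mul ai).congr
        fun v => (UCBundle.form_apply01 v.1 v.2).trans (by simp; ring)
    · exact (a.mul d1).congr fun v => rfl
    · exact ((b.mul d1).sub ((contMDiff_const (c := (2 : ℝ)⁻¹)).mul (d2.mul ai))).congr
        fun v => (UCBundle.form_apply11 v.1 v.2).trans (by simp; ring)
  equivariant := by
    intro g e v
    exact (congrArg (fun w : ℝ × ℝ × ℝ =>
      (UCBundle.form (e.1, e.2 * g) w : Matrix (Fin 2) (Fin 2) ℝ))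
        (UCBundle.mfderiv_act g e v)).trans (UCBundle.form_act g e v)
  flow := by
    intro A hA e t
    exact UCBundle.flow hA e t

/-- The universal covering `ℝ → ℙ¹`, `φ ↦ [cos φ : sin φ]`; the affine coordinate is
`x = cot φ`, and `x = ∞` at the multiples of `π`. -/
def ucProj (φ : ℝ) : ℙ ℝ (Fin 2 → ℝ) :=
  Projectivization.mk ℝ ![Real.cos φ, Real.sin φ] (by
    intro h
    have h0 : Real.cos φ = 0 := by simpa using congrFun h 0
    have h1 : Real.sin φ = 0 := by simpa using congrFun h 1
    have := Real.sin_sq_add_cos_sq φ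
    simp [h0, h1] at this)

namespace ProjectiveConnection

section
variable {E : Type*} [TopologicalSpace E] [ChartedSpace Model3 E] [IsManifold I3 ∞ E]
  {C : Type*} [TopologicalSpace C] [ChartedSpace ℝ C]
  {E' : Type*} [TopologicalSpace E'] [ChartedSpace Model3 E'] [IsManifold I3 ∞ E']
  {C' : Type*} [TopologicalSpace C'] [ChartedSpace ℝ C']

/-- The vector field on the total space on which the connection form is constant, equal to `A`. -/
def vectorField (P : ProjectiveConnection E C) (A : sl (Fin 2) ℝ) (e : E) : TangentSpace I3 e :=
  (P.Ω e).symm A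

/-- A projective connection is complete if the flows of all the vector fields `Ω⁻¹ A` are defined
for all time. -/
def IsComplete (P : ProjectiveConnection E C) : Prop :=
  ∀ (A : sl (Fin 2) ℝ) (e : E),
    ∃ γ : ℝ → E, γ 0 = e ∧ IsMIntegralCurve (I := I3) γ (P.vectorField A)

/-- `Φ : E → E'`, over `f : C → C'`, is an equivariant smooth bundle map that pulls back the
connection form to the connection form (hence is a local diffeomorphism, as is `f`). -/
structure IsMorphism (P : ProjectiveConnection E C) (P' : ProjectiveConnection E' C')
    (Φ : E → E') (f : C → C') : Prop where
  contMDiff : ContMDiff I3 I3 ∞ Φ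
  contMDiff_base : ContMDiff 𝓘(ℝ, ℝ) 𝓘(ℝ, ℝ) ∞ f
  proj_eq : ∀ e, P'.proj (Φ e) = f (P.proj e)
  map_act : ∀ e g, Φ (P.act e g) = P'.act (Φ e) g
  map_Ω : ∀ e (v : TangentSpace I3 e), P'.Ω (Φ e) (mfderiv I3 I3 Φ e v) = P.Ω e v

/-- An isomorphism of projective connections: a morphism with an inverse that is a morphism. -/
structure IsIsomorphism (P : ProjectiveConnection E C) (P' : ProjectiveConnection E' C')
    (Φ : E ≃ E') (f : C ≃ C') : Prop where
  hom : IsMorphism P P' Φ f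
  inv : IsMorphism P' P Φ.symm f.symm

/-- The projective connection `P` pulled back to the universal cover of its curve. -/
structure UniversalCover (P : ProjectiveConnection E C) where
  /-- the universal cover of `C` -/
  Curve : Type u₃
  /-- the total space of the pullback bundle -/
  Bundle : Type u₄
  [topCurve : TopologicalSpace Curve]
  [t2Curve : T2Space Curve]
  [secondCountableCurve : SecondCountableTopology Curve]
  [chartedCurve : ChartedSpace ℝ Curve]
  [manifoldCurve : IsManifold 𝓘(ℝ, ℝ) ∞ Curve]
  [simplyConnected : SimplyConnectedSpace Curve]
  [topBundle : TopologicalSpace Bundle]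
  [t2Bundle : T2Space Bundle]
  [secondCountableBundle : SecondCountableTopology Bundle]
  [chartedBundle : ChartedSpace Model3 Bundle]
  [manifoldBundle : IsManifold I3 ∞ Bundle]
  /-- the pullback connection -/
  conn : ProjectiveConnection Bundle Curve
  /-- the covering map of curves -/
  cover : Curve → C
  /-- the map of total spaces over it -/
  bundleMap : Bundle → E
  isCoveringMap : IsCoveringMap cover
  isMorphism : IsMorphism conn P bundleMap cover

attribute [instance] UniversalCover.topCurve UniversalCover.t2Curve
  UniversalCover.secondCountableCurve UniversalCover.chartedCurve UniversalCover.manifoldCurve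
  UniversalCover.simplyConnected UniversalCover.topBundle UniversalCover.t2Bundle
  UniversalCover.secondCountableBundle UniversalCover.chartedBundle UniversalCover.manifoldBundle

/-- A developing map: a map `dev : C → ℙ¹` covered by an equivariant map `frame : E → PGL(2, ℝ)`
that pulls back the Maurer–Cartan form `g⁻¹ dg` to `Ω`, so that the connection is the pullback by
`dev` of the model `PGL(2, ℝ) → ℙ¹`.  Maps to `PGL(2, ℝ)` are differentiated through local lifts
`g` to `GL(2, ℝ)`, chosen so that `g⁻¹ dg` is trace free. -/
structure DevelopingMap (P : ProjectiveConnection E C) where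
  /-- the map of curves -/
  dev : C → ℙ ℝ (Fin 2 → ℝ)
  /-- the map of total spaces -/
  frame : E → PGL(2, ℝ)
  dev_proj : ∀ e, dev (P.proj e) = frame e • basePoint
  frame_act : ∀ e g, frame (P.act e g) = frame e * g.toPGL
  maurerCartan : ∀ e₀ : E, ∃ V : Set E, IsOpen V ∧ e₀ ∈ V ∧ ∃ g : E → GL (Fin 2) ℝ,
    (∀ i j, ContMDiffOn I3 𝓘(ℝ, ℝ) ∞ (fun x => (g x : Matrix (Fin 2) (Fin 2) ℝ) i j) V) ∧
    ∀ e ∈ V, frame e = ProjGenLinGroup.mk (g e) ∧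
      ∀ (v : TangentSpace I3 e) (i j : Fin 2),
        mfderiv I3 𝓘(ℝ, ℝ) (fun x => (g x : Matrix (Fin 2) (Fin 2) ℝ) i j) e v =
          ((g e : Matrix (Fin 2) (Fin 2) ℝ) * (P.Ω e v : Matrix (Fin 2) (Fin 2) ℝ)) i j

/-- The developing map identifies the curve with the universal cover of the projective line: it
lifts through `ucProj : ℝ → ℙ¹` to a diffeomorphism from the curve to `ℝ`. -/
def DevelopingMap.IdentifiesWithUniversalCover {P : ProjectiveConnection E C}
    (D : P.DevelopingMap) : Prop :=
  ∃ δ : C ≃ₘ⟮𝓘(ℝ, ℝ), 𝓘(ℝ, ℝ)⟯ ℝ, ∀ c, D.dev c = ucProj (δ c)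

/-- `P` is isomorphic to the quotient of the universal cover of the projective line by an
automorphism acting on the base by `τ`: for the automorphism `T` over `τ`, there is a surjective
morphism (a local diffeomorphism) from the model to `P` whose fibres are the orbits of the group
generated by `T`. -/
def IsModelQuotient (P : ProjectiveConnection E C) (τ : Equiv.Perm ℝ) : Prop :=
  ∃ T : Equiv.Perm UCBundle, IsIsomorphism ucModel ucModel T τ ∧
    ∃ (Φ : UCBundle → E) (f : ℝ → C), IsMorphism ucModel P Φ f ∧ Function.Surjective Φ ∧
      ∀ x y, Φ x = Φ y ↔ ∃ k : ℤ, (T ^ k) x = y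

/-- `σ` is the lift to the universal cover of the projective line of the affine map
`g = affine a b`, that fixes all the points at infinity. -/
structure IsAffineLift (g : StructureGroup) (σ : ℝ → ℝ) : Prop where
  continuous : Continuous σ
  map_infty : ∀ k : ℤ, σ (k * Real.pi) = k * Real.pi
  lifts : ∀ φ, ucProj (σ φ) = g.toPGL • ucProj φ

/-- Elliptic: the universal cover of the projective line (open), or its quotient by
`φ ↦ φ + θ` with `θ ≠ 0` (closed). -/
def IsElliptic (P : ProjectiveConnection E C) : Prop :=
  (∃ (Φ : UCBundle ≃ E) (f : ℝ ≃ C), IsIsomorphism ucModel P Φ f) ∨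
    ∃ θ : ℝ, θ ≠ 0 ∧ P.IsModelQuotient (Equiv.addRight θ)

/-- Closed parabolic of type (2): the quotient of the universal cover of the projective line by
`x ↦ x + 1` followed by the translation by `n ≠ 0` copies of the projective line. -/
def IsClosedParabolicTwo (P : ProjectiveConnection E C) : Prop :=
  ∃ n : ℤ, n ≠ 0 ∧ ∃ (σ : ℝ → ℝ) (τ : Equiv.Perm ℝ),
    IsAffineLift (StructureGroup.affine 1 1) σ ∧ (∀ φ, τ φ = σ φ + n * Real.pi) ∧
    P.IsModelQuotient τ

/-- Closed hyperbolic of type (2): the quotient of the universal cover of the projective line by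
`x ↦ r * x`, with `r > 1`, followed by the translation by `n ≠ 0` copies of the projective line. -/
def IsClosedHyperbolicTwo (P : ProjectiveConnection E C) : Prop :=
  ∃ (r : ℝˣ) (n : ℤ), 1 < (r : ℝ) ∧ n ≠ 0 ∧ ∃ (σ : ℝ → ℝ) (τ : Equiv.Perm ℝ),
    IsAffineLift (StructureGroup.affine r 0) σ ∧ (∀ φ, τ φ = σ φ + n * Real.pi) ∧
    P.IsModelQuotient τ

end

end ProjectiveConnection

end

/-! The rotations `rot φ` act simply transitively on the universal cover of the projective line, so
one vector field controls everything: the field `Ω⁻¹ rotGen` on `E`. If an integral curve `γ` of it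
is defined for all time, then `(φ, g) ↦ γ φ · g` is a morphism from `ucModel` to `P`
(`isMorphism_of_isMIntegralCurve`): equivariance of `Ω` settles the direction of `γ`, and the flow
axiom the directions of the fibre. A morphism from the model is determined by one value
(`IsMorphism.eq_of_apply_eq`), and the model is complete (`ucModel_isComplete`), hence homogeneous
under its automorphisms. So two morphisms from the model to `P` whose images share a point differ by
an automorphism. Over a connected curve it follows that a morphism is surjective, and that its base
map `ℝ → C` is a covering, the quotient by a deck group that acts freely on `ℝ` with discrete
orbits. Such a group is trivial or generated by one element (`exists_generator_of_free`).

Completeness and developing maps: the rotation field stays complete on the universal cover, and a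
covering of a simply connected curve by `ℝ` is injective, so the pulled back connection is
isomorphic to the model. There every developing map is `ucProj` followed by a projectivity, which
lifts to a diffeomorphism of `ℝ`. Conversely, if the curve is identified with `ℝ`, the points whose
frame is `rot s` form a complete integral curve of `rotGen`, and the resulting morphism from the
model carries completeness to the cover and then to `P`.

Completeness and the list: a generator of the deck group covers an element of PGL(2, ℝ), which
`exists_conj_normalForm` conjugates to a rotation, to `x ↦ x + 1`, or to `x ↦ r x`. Freeness makes
the generator increasing and excludes `n = 0` and `r < 0`. Conversely, quotients of the complete
model are complete. -/

noncomputable section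

/-! ### The inverse function theorem on manifolds -/

section InverseFunction

variable {V W : Type*} [NormedAddCommGroup V] [NormedSpace ℝ V] [CompleteSpace V]
  [NormedAddCommGroup W] [NormedSpace ℝ W]
  {H K : Type*} [TopologicalSpace H] [TopologicalSpace K]
  {I : ModelWithCorners ℝ V H} {J : ModelWithCorners ℝ W K} [I.Boundaryless]
  {M N : Type*} [TopologicalSpace M] [ChartedSpace H M] [IsManifold I ∞ M]
  [TopologicalSpace N] [ChartedSpace K N] [IsManifold J ∞ N]

/-- The inverse function theorem on manifolds without boundary. -/
theorem ContMDiff.isLocalDiffeomorphAt_of_mfderiv {f : M → N} (hf : ContMDiff I J ∞ f) (x : M)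
    (e : V ≃L[ℝ] W) (he : HasMFDerivAt I J f x e.toContinuousLinearMap) :
    IsLocalDiffeomorphAt I J ∞ f x := by
  let X := extChartAt I x
  let Y := extChartAt J (f x)
  let F : V → W := writtenInExtChartAt I J x f
  let U : Set V := X.target ∩ X.symm ⁻¹' (f ⁻¹' Y.source)
  have hU : IsOpen U := by
    refine (continuousOn_extChartAt_symm x).isOpen_inter_preimage (isOpen_extChartAt_target x) ?_
    exact (isOpen_extChartAt_source (f x)).preimage hf.continuous
  have hxU : X x ∈ U := ⟨mem_extChartAt_target x, by
    simp only [Set.mem_preimage, X, extChartAt_to_inv]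
    exact mem_extChartAt_source (f x)⟩
  have hF : ContDiffOn ℝ ∞ F U := by
    rw [← contMDiffOn_iff_contDiffOn]
    refine (contMDiffOn_extChartAt (I := J) (x := f x) (n := ∞)).comp
      (hf.comp_contMDiffOn ((contMDiffOn_extChartAt_symm x).mono fun y hy => hy.1)) ?_
    intro y hy
    rw [← extChartAt_source J]
    exact hy.2
  have hFx : HasFDerivAt F (e : V →L[ℝ] W) (X x) := by
    have h : HasFDerivWithinAt F (e : V →L[ℝ] W) (Set.range I) (X x) := he.2
    rw [I.range_eq_univ] at h
    exact hasFDerivWithinAt_univ.1 h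
  have hFa : ContDiffAt ℝ ∞ F (X x) := hF.contDiffAt (hU.mem_nhds hxU)
  let E := hFa.toOpenPartialHomeomorph F hFx (by simp)
  have hE : X x ∈ E.source := hFa.mem_toOpenPartialHomeomorph_source hFx (by simp)
  have hd : ContinuousOn (fderiv ℝ F) U := hF.continuousOn_fderiv_of_isOpen hU (by simp)
  -- Smoothness of the local inverse at a point needs the derivative to be invertible there, so the
  -- domain is cut down to the open set where it is.
  let S : Set V := U ∩ fderiv ℝ F ⁻¹' (Set.range ((↑) : (V ≃L[ℝ] W) → V →L[ℝ] W))
  have hS : IsOpen S := hd.isOpen_inter_preimage hU (ContinuousLinearEquiv.isOpen)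
  have hxS : X x ∈ S := ⟨hxU, e, by rw [hFx.fderiv]⟩
  let E' := E.restrOpen S hS
  have hE'F : ∀ v ∈ E'.source, E' v = F v := fun v _ => rfl
  have hsymm : ContDiffOn ℝ ∞ E'.symm E'.target := by
    intro w hw
    have h1 : E'.symm w ∈ E'.source := E'.map_target hw
    have h2 : E'.symm w ∈ S := h1.2
    obtain ⟨e', he'⟩ := h2.2
    have h3 : ContDiffAt ℝ ∞ F (E'.symm w) := hF.contDiffAt (hU.mem_nhds h2.1)
    refine (E'.contDiffAt_symm hw (f₀' := e') ?_ h3).contDiffWithinAt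
    rw [he']
    exact (h3.differentiableAt (by simp)).hasFDerivAt
  have hmaps : ∀ v ∈ E'.source, F v ∈ Y.target := by
    intro v hv
    have := Y.map_source hv.2.1.2
    exact this
  have hYF : ∀ v ∈ E'.source, Y.symm (F v) = f (X.symm v) := by
    intro v hv
    exact Y.left_inv hv.2.1.2
  let Φ : PartialDiffeomorph I J M N ∞ :=
    { toFun := f
      invFun := fun y => X.symm (E'.symm (Y y))
      source := X.source ∩ X ⁻¹' E'.source
      target := Y.source ∩ Y ⁻¹' E'.target
      map_source' := by
        rintro m ⟨h1, h2⟩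
        have h3 := hYF _ h2
        rw [X.left_inv h1] at h3
        rw [← h3]
        refine ⟨Y.map_target (hmaps _ h2), ?_⟩
        rw [Set.mem_preimage, Y.right_inv (hmaps _ h2)]
        exact E'.map_source h2
      map_target' := by
        rintro n ⟨h1, h2⟩
        have h3 := E'.map_target h2
        refine ⟨X.map_target h3.2.1.1, ?_⟩
        rw [Set.mem_preimage, X.right_inv h3.2.1.1]
        exact h3
      left_inv' := by
        rintro m ⟨h1, h2⟩
        have h3 := hYF _ h2
        rw [X.left_inv h1] at h3
        rw [← h3, Y.right_inv (hmaps _ h2)]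
        change X.symm (E'.symm (E' (X m))) = m
        rw [E'.left_inv h2, X.left_inv h1]
      right_inv' := by
        rintro n ⟨h1, h2⟩
        have h3 := E'.map_target h2
        rw [← hYF _ h3]
        change Y.symm (E' (E'.symm (Y n))) = n
        rw [E'.right_inv h2, Y.left_inv h1]
      open_source := (continuousOn_extChartAt x).isOpen_inter_preimage
        (isOpen_extChartAt_source x) E'.open_source
      open_target := (continuousOn_extChartAt (f x)).isOpen_inter_preimage
        (isOpen_extChartAt_source (f x)) E'.open_target
      contMDiffOn_toFun := hf.contMDiffOn
      contMDiffOn_invFun := by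
        refine (contMDiffOn_extChartAt_symm x).comp ((contMDiffOn_iff_contDiffOn.2 hsymm).comp
          ((contMDiffOn_extChartAt (I := J) (x := f x) (n := ∞)).mono ?_) ?_) ?_
        · intro n hn; simpa [Y] using hn.1
        · intro n hn; exact hn.2
        · intro n hn; exact (E'.map_target hn.2).2.1.1 }
  exact ⟨Φ, ⟨mem_extChartAt_source x, hE, hxS⟩, fun _ _ => rfl⟩

end InverseFunction

/-! ### Regularity of integral curves -/

section IntegralCurve

variable {V : Type*} [NormedAddCommGroup V] [NormedSpace ℝ V]
  {H : Type*} [TopologicalSpace H] {I : ModelWithCorners ℝ V H}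
  {M : Type*} [TopologicalSpace M] [ChartedSpace H M]

theorem contMDiffAt_of_extChartAt_comp {γ : ℝ → M} {t : ℝ} {n : WithTop ℕ∞}
    (hc : ContinuousAt γ t)
    (h : ContDiffAt ℝ n (extChartAt I (γ t) ∘ γ) t) : ContMDiffAt 𝓘(ℝ, ℝ) I n γ t := by
  rw [contMDiffAt_iff_target]
  exact ⟨hc, h.contMDiffAt⟩

variable [IsManifold I ∞ M]

/-- Integral curves of smooth vector fields are smooth. -/
theorem IsMIntegralCurve.contMDiff {v : (x : M) → TangentSpace I x}
    (hv : ContMDiff I I.tangent ∞ (fun x => (⟨x, v x⟩ : TangentBundle I M)))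
    {γ : ℝ → M} (hγ : IsMIntegralCurve γ v) : ContMDiff 𝓘(ℝ, ℝ) I ∞ γ := by
  have : IsManifold I 1 M := IsManifold.of_le (n := ∞) (by simp)
  -- Bootstrap: if `γ` is of class Cⁿ, so is its velocity `v ∘ γ`, and then `γ` is of class Cⁿ⁺¹.
  have key : ∀ n : ℕ, ContMDiff 𝓘(ℝ, ℝ) I n γ := by
    intro n
    induction n with
    | zero => exact contMDiff_zero_iff.2 hγ.continuous
    | succ n ih =>
      intro t
      have hd := (hγ.isMIntegralCurveAt t).eventually_hasDerivAt
      have hsm : ContMDiffAt 𝓘(ℝ, ℝ) 𝓘(ℝ, V) n (fun s =>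
          tangentCoordChange I (γ s) (γ t) (γ s) (v (γ s))) t := by
        have h1 : ContMDiffAt 𝓘(ℝ, ℝ) I.tangent n
            (fun s => (⟨γ s, v (γ s)⟩ : TangentBundle I M)) t :=
          ((hv.of_le (by exact_mod_cast le_top)).comp ih) t
        rw [Bundle.contMDiffAt_totalSpace] at h1
        exact h1.2
      refine contMDiffAt_of_extChartAt_comp hγ.continuous.continuousAt ?_
      have h2 : ContDiffAt ℝ (n + 1) (extChartAt I (γ t) ∘ γ) t := by
        rw [contDiffAt_succ_iff_hasFDerivAt]
        obtain ⟨u, hu, hu'⟩ := Filter.eventually_iff_exists_mem.1 hd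
        refine ⟨_, ⟨u, hu, fun s hs => (hu' s hs).hasFDerivAt⟩, ?_⟩
        exact (ContinuousLinearMap.toSpanSingletonCLE (𝕜 := ℝ) (E := V)).contDiff.contDiffAt.comp t
          hsm.contDiffAt
      exact_mod_cast h2
  exact contMDiff_infty.2 key

end IntegralCurve

/-! ### Constant vector fields and morphisms of connections -/

/-- The infinitesimal generator of the rotations. -/
def rotGen : sl (Fin 2) ℝ := ⟨!![0, -1; 1, 0], by simp [sl, Matrix.trace_fin_two]⟩

namespace ProjectiveConnection

section
variable {E : Type*} [TopologicalSpace E] [ChartedSpace Model3 E] [IsManifold I3 ∞ E]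
  {C : Type*} [TopologicalSpace C] [ChartedSpace ℝ C]

/-- In a local trivialization of the tangent bundle `Ω` becomes a smooth family `N` of invertible
operators on `ℝ³`, and inversion of operators is smooth. -/
theorem contMDiff_vectorField (P : ProjectiveConnection E C) (A : sl (Fin 2) ℝ) :
    ContMDiff I3 I3.tangent ∞ (fun e => (⟨e, P.vectorField A e⟩ : TangentBundle I3 E)) := by
  intro e₀
  -- Any linear isomorphism with `ℝ³` would serve; this one has explicit coordinates.
  let κ : sl (Fin 2) ℝ ≃ₗ[ℝ] ℝ × ℝ × ℝ := (UCBundle.form ((0, 1) : UCBundle)).symm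
  let b := trivializationAt (ℝ × ℝ × ℝ) (TangentSpace I3 : E → Type _) e₀
  have hb : IsOpen b.baseSet := b.open_baseSet
  have he₀ : e₀ ∈ b.baseSet := FiberBundle.mem_baseSet_trivializationAt' e₀
  let Ω' (x : E) : (ℝ × ℝ × ℝ) ≃ₗ[ℝ] sl (Fin 2) ℝ := P.Ω x
  let N (x : E) : (ℝ × ℝ × ℝ) →L[ℝ] ℝ × ℝ × ℝ :=
    LinearMap.toContinuousLinearMap (κ.toLinearMap ∘ₗ (Ω' x).toLinearMap ∘ₗ
      (b.symmₗ ℝ x : (ℝ × ℝ × ℝ) →ₗ[ℝ] (ℝ × ℝ × ℝ)))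
  have hsec (w : E → ℝ × ℝ × ℝ) (hw : ContMDiffAt I3 𝓘(ℝ, ℝ × ℝ × ℝ) ∞ w e₀) :
      ContMDiffAt I3 I3.tangent ∞ (fun x => (⟨x, b.symm x (w x)⟩ : TangentBundle I3 E)) e₀ := by
    have h1 := (b.contMDiffOn_symm (IB := I3) (n := ∞)).contMDiffAt
      (b.open_target.mem_nhds (x := (e₀, w e₀)) (by rw [b.target_eq]; exact ⟨he₀, trivial⟩))
    have h2 := h1.comp e₀ (f := fun x => (x, w x)) (contMDiffAt_id.prodMk hw)
    refine h2.congr_of_eventuallyEq ?_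
    filter_upwards [hb.mem_nhds he₀] with x hx
    exact (b.mk_symm hx (w x))
  have hN0 : ∀ x ∈ b.baseSet, ∀ w, N x w = κ (P.Ω x (b.symm x w)) := by
    intro x hx w
    simp only [N, LinearMap.coe_toContinuousLinearMap']
    exact congrArg (fun u => κ (P.Ω x u)) (b.symmₗ_apply hx w)
  have hN1 (w : ℝ × ℝ × ℝ) : ContMDiffAt I3 𝓘(ℝ, ℝ × ℝ × ℝ) ∞ (fun x => N x w) e₀ := by
    have h := hsec (fun _ => w) contMDiffAt_const
    have h10 := (P.contMDiff_Ω 1 0).contMDiffAt.comp e₀ h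
    have h00 := (P.contMDiff_Ω 0 0).contMDiffAt.comp e₀ h
    have h01 := (P.contMDiff_Ω 0 1).contMDiffAt.comp e₀ h
    have hκ : ∀ A : sl (Fin 2) ℝ, κ A = (A.1 1 0, 2 * A.1 0 0, A.1 0 1 + A.1 1 0) := by
      intro A
      refine Prod.ext ?_ (Prod.ext ?_ ?_) <;> simp [κ, UCBundle.form]
    refine (h10.prodMk_space (((contMDiffAt_const (c := (2 : ℝ))).mul h00).prodMk_space
      (h01.add h10))).congr_of_eventuallyEq ?_
    filter_upwards [hb.mem_nhds he₀] with x hx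
    exact (hN0 x hx w).trans (hκ _)
  -- An operator is the sum of its values on the standard basis times the dual coordinates, so
  -- pointwise smoothness of `N` gives smoothness in the operator space.
  have hN : ContMDiffAt I3 𝓘(ℝ, (ℝ × ℝ × ℝ) →L[ℝ] ℝ × ℝ × ℝ) ∞ N e₀ := by
    have hs (l : (ℝ × ℝ × ℝ) →L[ℝ] ℝ) (w : ℝ × ℝ × ℝ) : ContMDiffAt I3
        𝓘(ℝ, (ℝ × ℝ × ℝ) →L[ℝ] ℝ × ℝ × ℝ) ∞ (fun x => l.smulRight (N x w)) e₀ :=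
      (ContinuousLinearMap.contMDiff (ContinuousLinearMap.smulRightL ℝ _ _ l)).contMDiffAt.comp
        e₀ (hN1 w)
    refine (((hs (.fst ℝ ℝ (ℝ × ℝ)) (1, 0, 0)).add
      (hs ((ContinuousLinearMap.fst ℝ ℝ ℝ).comp (.snd ℝ ℝ (ℝ × ℝ))) (0, 1, 0))).add
      (hs ((ContinuousLinearMap.snd ℝ ℝ ℝ).comp (.snd ℝ ℝ (ℝ × ℝ))) (0, 0, 1))).congr_of_eventuallyEq
      (.of_forall fun x => ContinuousLinearMap.ext fun w => ?_)
    have hw : w = w.1 • (1, 0, 0) + w.2.1 • (0, 1, 0) + w.2.2 • (0, 0, 1) := by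
      simp
    refine (congrArg (N x) hw).trans ?_
    simp only [map_add, map_smul]
    rfl
  have hinv (x : E) (hx : x ∈ b.baseSet) : ∃ e : (ℝ × ℝ × ℝ) ≃L[ℝ] ℝ × ℝ × ℝ, N x = e := by
    let l : (ℝ × ℝ × ℝ) ≃ₗ[ℝ] (ℝ × ℝ × ℝ) := (b.linearEquivAt ℝ x hx).symm
    refine ⟨(l.trans ((Ω' x).trans κ)).toContinuousLinearEquiv, ?_⟩
    refine ContinuousLinearMap.ext fun w => (hN0 x hx w).trans ?_
    rfl
  have hNinv : ContMDiffAt I3 𝓘(ℝ, (ℝ × ℝ × ℝ) →L[ℝ] ℝ × ℝ × ℝ) ∞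
      (fun x => ContinuousLinearMap.inverse (N x)) e₀ := by
    obtain ⟨e, he⟩ := hinv e₀ he₀
    have := contDiffAt_map_inverse (𝕜 := ℝ) (n := ∞) e
    rw [← he] at this
    exact this.contMDiffAt.comp e₀ hN
  refine (hsec (fun x => ContinuousLinearMap.inverse (N x) (κ A))
    (hNinv.clm_apply contMDiffAt_const)).congr_of_eventuallyEq ?_
  filter_upwards [hb.mem_nhds he₀] with x hx
  obtain ⟨e, he⟩ := hinv x hx
  have h1 : N x (ContinuousLinearMap.inverse (N x) (κ A)) = κ A := by
    rw [he, ContinuousLinearMap.inverse_equiv]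
    exact e.apply_symm_apply _
  have h2 : P.Ω x (b.symm x (ContinuousLinearMap.inverse (N x) (κ A))) = A :=
      κ.injective ((hN0 x hx _).symm.trans h1)
  congr 1
  exact ((P.Ω x).symm_apply_eq).2 h2.symm

theorem proj_act (P : ProjectiveConnection E C) (e : E) (g : StructureGroup) :
    P.proj (P.act e g) = P.proj e := by
  obtain ⟨U, -, hU, σ, τ, -, -, h1, h2⟩ := P.locally_trivial (P.proj e)
  have h := h2 e hU
  conv_lhs => rw [← h, ← P.act_mul]
  exact (h1 _ hU _).1

theorem exists_act_eq (P : ProjectiveConnection E C) {e e' : E} (h : P.proj e = P.proj e') :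
    ∃ g, P.act e g = e' := by
  obtain ⟨U, -, hU, σ, τ, -, -, -, h2⟩ := P.locally_trivial (P.proj e)
  have he := h2 e hU
  have he' := h2 e' (by rwa [Set.mem_preimage, ← h])
  refine ⟨(τ e)⁻¹ * τ e', ?_⟩
  calc P.act e ((τ e)⁻¹ * τ e')
      = P.act (P.act (σ (P.proj e)) (τ e)) ((τ e)⁻¹ * τ e') := by rw [he]
    _ = e' := by rw [← P.act_mul, mul_inv_cancel_left, h, he']

theorem act_injective (P : ProjectiveConnection E C) (e : E) :
    Function.Injective (P.act e) := by
  intro g g' h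
  obtain ⟨U, -, hU, σ, τ, -, -, h1, h2⟩ := P.locally_trivial (P.proj e)
  have he := h2 e hU
  rw [← he, ← P.act_mul, ← P.act_mul] at h
  have := congrArg τ h
  rw [(h1 _ hU _).2, (h1 _ hU _).2] at this
  exact mul_left_cancel this

theorem proj_surjective (P : ProjectiveConnection E C) : Function.Surjective P.proj := by
  intro c
  obtain ⟨U, -, hU, σ, τ, -, -, h1, -⟩ := P.locally_trivial c
  exact ⟨_, (h1 c hU 1).1⟩

theorem act_act_inv (P : ProjectiveConnection E C) (e : E) (g : StructureGroup) :
    P.act (P.act e g⁻¹) g = e := by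
  rw [← P.act_mul, inv_mul_cancel, P.act_one]

theorem contMDiff_act_right (P : ProjectiveConnection E C) (g : StructureGroup) :
    ContMDiff I3 I3 ∞ (fun e => P.act e g) :=
  P.contMDiff_act.comp (contMDiff_id.prodMk contMDiff_const)

/-- Integral curves of one vector field starting at the same point agree. -/
theorem integralCurve_unique [T2Space E] (P : ProjectiveConnection E C) {A : sl (Fin 2) ℝ}
    {γ γ' : ℝ → E} (hγ : IsMIntegralCurve (I := I3) γ (P.vectorField A))
    (hγ' : IsMIntegralCurve (I := I3) γ' (P.vectorField A)) {t : ℝ} (h : γ t = γ' t) : γ = γ' := by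
  have : IsManifold I3 1 E := IsManifold.of_le (n := ∞) (by simp)
  exact isMIntegralCurve_Ioo_eq_of_contMDiff_boundaryless (t₀ := t)
    ((P.contMDiff_vectorField A).of_le (by simp)) hγ hγ' h

variable {E' : Type*} [TopologicalSpace E'] [ChartedSpace Model3 E'] [IsManifold I3 ∞ E']
  {C' : Type*} [TopologicalSpace C'] [ChartedSpace ℝ C']
  {E'' : Type*} [TopologicalSpace E''] [ChartedSpace Model3 E''] [IsManifold I3 ∞ E'']
  {C'' : Type*} [TopologicalSpace C''] [ChartedSpace ℝ C'']
  {P : ProjectiveConnection E C} {P' : ProjectiveConnection E' C'}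
  {P'' : ProjectiveConnection E'' C''}

namespace IsMorphism

variable {Φ : E → E'} {f : C → C'} (h : IsMorphism P P' Φ f)
include h

theorem hasMFDerivAt (e : E) : HasMFDerivAt I3 I3 Φ e (mfderiv I3 I3 Φ e) :=
  (h.contMDiff.mdifferentiableAt (by simp)).hasMFDerivAt

theorem comp {Φ' : E' → E''} {f' : C' → C''} (h' : IsMorphism P' P'' Φ' f') :
    IsMorphism P P'' (Φ' ∘ Φ) (f' ∘ f) where
  contMDiff := h'.contMDiff.comp h.contMDiff
  contMDiff_base := h'.contMDiff_base.comp h.contMDiff_base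
  proj_eq e := (h'.proj_eq _).trans (congrArg f' (h.proj_eq e))
  map_act e g := (congrArg Φ' (h.map_act e g)).trans (h'.map_act _ _)
  map_Ω e v := by
    rw [((h'.hasMFDerivAt (Φ e)).comp e (h.hasMFDerivAt e)).mfderiv]
    exact (h'.map_Ω _ _).trans (h.map_Ω e v)

theorem map_vectorField (A : sl (Fin 2) ℝ) (e : E) :
    mfderiv I3 I3 Φ e (P.vectorField A e) = P'.vectorField A (Φ e) := by
  refine ((P'.Ω (Φ e)).eq_symm_apply).2 ?_
  rw [h.map_Ω]
  exact (P.Ω e).apply_symm_apply A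

theorem isMIntegralCurve {A : sl (Fin 2) ℝ} {γ : ℝ → E}
    (hγ : IsMIntegralCurve (I := I3) γ (P.vectorField A)) :
    IsMIntegralCurve (I := I3) (Φ ∘ γ) (P'.vectorField A) := by
  intro t
  refine ((h.hasMFDerivAt (γ t)).comp t (hγ t)).congr_mfderiv (ContinuousLinearMap.ext fun r => ?_)
  refine Eq.trans (map_smul (mfderiv I3 I3 Φ (γ t)) _ _) ?_
  rw [h.map_vectorField]
  rfl

/-- Morphisms push integral curves of constant fields forward; in this way every quotient of the
model inherits its completeness. -/
theorem isComplete (hs : Function.Surjective Φ) (hc : P.IsComplete) : P'.IsComplete := by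
  intro A e'
  obtain ⟨e, rfl⟩ := hs e'
  obtain ⟨γ, h0, hγ⟩ := hc A e
  exact ⟨Φ ∘ γ, congrArg Φ h0, h.isMIntegralCurve hγ⟩

/-- The differential of `Φ` at `e` is `Ω'⁻¹ ∘ Ω`, a composite of isomorphisms. -/
theorem isLocalDiffeomorph : IsLocalDiffeomorph I3 I3 ∞ Φ := by
  intro e
  let Ω₁ : (ℝ × ℝ × ℝ) ≃ₗ[ℝ] sl (Fin 2) ℝ := P.Ω e
  let Ω₂ : (ℝ × ℝ × ℝ) ≃ₗ[ℝ] sl (Fin 2) ℝ := P'.Ω (Φ e)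
  refine h.contMDiff.isLocalDiffeomorphAt_of_mfderiv e
    (Ω₁.trans Ω₂.symm).toContinuousLinearEquiv
    ((h.hasMFDerivAt e).congr_mfderiv (ContinuousLinearMap.ext fun v => ?_))
  exact (Ω₂.eq_symm_apply).2 (h.map_Ω e v)

/-- Both actions are simply transitive on fibres, so `Φ` maps each fibre bijectively to a fibre.
Hence injectivity and surjectivity pass between `Φ` and `f` in both directions, as this lemma and
the next three record. -/
theorem surjective_of_base (hf : Function.Surjective f) : Function.Surjective Φ := by
  intro e'
  obtain ⟨c, hc⟩ := hf (P'.proj e')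
  obtain ⟨e, rfl⟩ := P.proj_surjective c
  obtain ⟨g, hg⟩ := P'.exists_act_eq ((h.proj_eq e).trans hc)
  exact ⟨P.act e g, by rw [h.map_act, hg]⟩

theorem surjective_base (hs : Function.Surjective Φ) : Function.Surjective f := by
  intro c
  obtain ⟨e', rfl⟩ := P'.proj_surjective c
  obtain ⟨e, rfl⟩ := hs e'
  exact ⟨_, (h.proj_eq e).symm⟩

theorem injective_of_base (hf : Function.Injective f) : Function.Injective Φ := by
  intro a b hab
  have h1 : P.proj a = P.proj b := hf (by rw [← h.proj_eq, ← h.proj_eq, hab])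
  obtain ⟨g, rfl⟩ := P.exists_act_eq h1
  rw [h.map_act] at hab
  have : P'.act (Φ a) g = P'.act (Φ a) 1 := by rw [← hab, P'.act_one]
  rw [P'.act_injective _ this, P.act_one]

theorem injective_base (hi : Function.Injective Φ) : Function.Injective f := by
  intro a b hab
  obtain ⟨a, rfl⟩ := P.proj_surjective a
  obtain ⟨b, rfl⟩ := P.proj_surjective b
  rw [← h.proj_eq, ← h.proj_eq] at hab
  obtain ⟨g, hg⟩ := P'.exists_act_eq hab
  rw [← h.map_act] at hg
  rw [← hi hg, P.proj_act]

/-- A bijective morphism is an isomorphism. -/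
theorem exists_isIsomorphism (hb : Function.Bijective Φ) :
    ∃ (Ψ : E ≃ E') (k : C ≃ C'), (Ψ : E → E') = Φ ∧ (k : C → C') = f ∧
      IsIsomorphism P P' Ψ k := by
  let d := h.isLocalDiffeomorph.diffeomorphOfBijective hb
  have hd : ∀ e, d.toEquiv e = Φ e := fun _ => rfl
  let k := Equiv.ofBijective f ⟨h.injective_base hb.1, h.surjective_base hb.2⟩
  have hk : ∀ c, k c = f c := fun _ => rfl
  have hsymm : ContMDiff I3 I3 ∞ d.toEquiv.symm := d.symm.contMDiff
  have hproj : ∀ e', P.proj (d.toEquiv.symm e') = k.symm (P'.proj e') := by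
    intro e'
    rw [k.eq_symm_apply, hk, ← h.proj_eq, ← hd, Equiv.apply_symm_apply]
  refine ⟨d.toEquiv, k, rfl, rfl, h, hsymm, ?_, hproj, ?_, ?_⟩
  · intro c
    obtain ⟨U, hUo, hU, σ, τ, hσ, -, h1, -⟩ := P'.locally_trivial c
    -- Near `c` the inverse of `f` is `P.proj ∘ Φ⁻¹ ∘ σ` for a local section `σ` of the target
    -- bundle.
    refine ((P.contMDiff_proj.comp hsymm).contMDiffAt.comp c
      ((hσ c hU).contMDiffAt (hUo.mem_nhds hU))).congr_of_eventuallyEq ?_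
    filter_upwards [hUo.mem_nhds hU] with x hx
    have := (h1 x hx 1).1
    rw [P'.act_one] at this
    simp only [Function.comp_apply, hproj, this]
  · intro e' g
    rw [Equiv.symm_apply_eq, hd, h.map_act, ← hd, Equiv.apply_symm_apply]
  · intro e' v
    obtain ⟨e, rfl⟩ := d.toEquiv.surjective e'
    have hid : HasMFDerivAt I3 I3 (Φ ∘ d.toEquiv.symm) (Φ e) _ :=
      HasMFDerivAt.comp (Φ e) (h.hasMFDerivAt _)
        ((hsymm.mdifferentiableAt (by simp)).hasMFDerivAt)
    have hid' : HasMFDerivAt I3 I3 (Φ ∘ d.toEquiv.symm) (Φ e) (ContinuousLinearMap.id ℝ _) :=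
      (hasMFDerivAt_id (Φ e)).congr_of_eventuallyEq
        (.of_forall fun y => d.toEquiv.apply_symm_apply y)
    have key := congrArg (fun l => l v) (hasMFDerivAt_unique hid hid')
    rw [← h.map_Ω]
    have h2 : ∀ (x : E') (hx : x = Φ e) (w : ℝ × ℝ × ℝ), w = v → P'.Ω x w = P'.Ω (Φ e) v := by
      rintro x rfl w rfl
      rfl
    exact h2 _ (d.toEquiv.apply_symm_apply _) _ key

end IsMorphism

theorem IsIsomorphism.symm {Φ : E ≃ E'} {f : C ≃ C'} (h : IsIsomorphism P P' Φ f) :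
    IsIsomorphism P' P Φ.symm f.symm := ⟨h.inv, h.hom⟩

theorem IsIsomorphism.trans {Φ : E ≃ E'} {f : C ≃ C'} {Φ' : E' ≃ E''} {f' : C' ≃ C''}
    (h : IsIsomorphism P P' Φ f) (h' : IsIsomorphism P' P'' Φ' f') :
    IsIsomorphism P P'' (Φ.trans Φ') (f.trans f') :=
  ⟨h.hom.comp h'.hom, h'.inv.comp h.inv⟩

end
end ProjectiveConnection

/-! ### Morphisms from the model as integral curves of the rotation field -/

namespace StructureGroup

@[simp] lemma exp_zero : exp (0 : Matrix (Fin 2) (Fin 2) ℝ) = 1 := by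
  obtain ⟨-, -, h1, h2⟩ := exp_coords (A := 0) rfl
  rw [NormedSpace.exp_zero] at h1 h2
  exact Prod.ext (Units.ext (by simpa using h1)) (by simpa using h2)

end StructureGroup

namespace UCBundle

lemma form_rot (φ : ℝ) (g : StructureGroup) :
    (form ((φ, g) : UCBundle) (1, 0, 0) : Matrix (Fin 2) (Fin 2) ℝ) =
      g.toMatrix⁻¹ * (rotGen : Matrix (Fin 2) (Fin 2) ℝ) * g.toMatrix := by
  have := form_eq ((φ, g) : UCBundle) (1, 0, 0)
  have h0 : !![(0 : ℝ), 0; 0, 0] = 0 := by ext i j; fin_cases i <;> fin_cases j <;> rfl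
  simpa [h0, rotGen] using this

lemma form_one_rot (φ : ℝ) : form ((φ, 1) : UCBundle) (1, 0, 0) = rotGen := by
  refine Subtype.ext ((form_rot φ 1).trans ?_)
  simp [StructureGroup.toMatrix_one]

lemma hasMFDerivAt_line (g : StructureGroup) (φ : ℝ) :
    HasMFDerivAt 𝓘(ℝ, ℝ) I3 (fun s : ℝ => ((s, g) : UCBundle)) φ
      ((1 : ℝ →L[ℝ] ℝ).smulRight ((1, 0, 0) : ℝ × ℝ × ℝ)) := by
  have h := hasMFDerivAt_mk (f := fun s : ℝ => ((s, g) : UCBundle))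
    (hasMFDerivAt_id (I := 𝓘(ℝ, ℝ)) φ) (hasMFDerivAt_const (I := 𝓘(ℝ, ℝ)) (g.1 : ℝ) φ)
    (hasMFDerivAt_const (I := 𝓘(ℝ, ℝ)) g.2 φ)
  refine h.congr_mfderiv (ContinuousLinearMap.ext fun (r : ℝ) => ?_)
  refine Prod.ext ?_ (Prod.ext ?_ ?_)
  · exact (mul_one r).symm
  · exact (mul_zero r).symm
  · exact (mul_zero r).symm

lemma isMIntegralCurve_line :
    IsMIntegralCurve (I := I3) (fun s : ℝ => ((s, 1) : UCBundle)) (ucModel.vectorField rotGen) := by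
  intro φ
  have h : ucModel.vectorField rotGen ((φ, 1) : UCBundle) = ((1, 0, 0) : ℝ × ℝ × ℝ) :=
    ((form ((φ, 1) : UCBundle)).symm_apply_eq).2 (form_one_rot φ).symm
  rw [h]
  exact hasMFDerivAt_line 1 φ

end UCBundle

namespace ProjectiveConnection

section
variable {E : Type*} [TopologicalSpace E] [ChartedSpace Model3 E] [IsManifold I3 ∞ E]
  {C : Type*} [TopologicalSpace C] [ChartedSpace ℝ C]
  {P : ProjectiveConnection E C}

/-- An integral curve of the rotation field spans a morphism from the model. -/
theorem isMorphism_of_isMIntegralCurve {γ : ℝ → E}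
    (hγ : IsMIntegralCurve (I := I3) γ (P.vectorField rotGen)) :
    IsMorphism ucModel P (fun x => P.act (γ x.1) x.2) (P.proj ∘ γ) := by
  let Φ : UCBundle → E := fun x => P.act (γ x.1) x.2
  have hsm : ContMDiff 𝓘(ℝ, ℝ) I3 ∞ γ := hγ.contMDiff (P.contMDiff_vectorField rotGen)
  have hΦ : ContMDiff I3 I3 ∞ Φ :=
    P.contMDiff_act.comp ((hsm.comp UCBundle.contMDiff_fst_coord).prodMk contMDiff_snd)
  have hΦd (x : UCBundle) : HasMFDerivAt I3 I3 Φ x (mfderiv I3 I3 Φ x) :=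
    (hΦ.mdifferentiableAt (by simp)).hasMFDerivAt
  refine ⟨hΦ, P.contMDiff_proj.comp hsm, fun x => P.proj_act _ _, fun x g => P.act_mul _ _ _, ?_⟩
  rintro x v
  let D : (ℝ × ℝ × ℝ) →ₗ[ℝ] sl (Fin 2) ℝ :=
    (P.Ω (Φ x)).toLinearMap ∘ₗ (mfderiv I3 I3 Φ x).toLinearMap
  change D v = UCBundle.form x v
  -- Along the curve both forms equal `g⁻¹ * rotGen * g`, one by equivariance of `Ω` and the other
  -- by `form_rot`.
  have h1 : D (1, 0, 0) = UCBundle.form x (1, 0, 0) := by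
    have ha := (hΦd x).comp x.1 (f := fun s : ℝ => ((s, x.2) : UCBundle))
      (UCBundle.hasMFDerivAt_line x.2 x.1)
    have hb := HasMFDerivAt.comp x.1 (g := fun e => P.act e x.2)
      (((P.contMDiff_act_right x.2).mdifferentiableAt (by simp)).hasMFDerivAt) (hγ x.1)
    have hc := congrArg (fun l => l (1 : ℝ)) (hasMFDerivAt_unique ha hb)
    refine Subtype.ext (Eq.trans ?_ (UCBundle.form_rot x.1 x.2).symm)
    have hd : (P.vectorField rotGen (γ x.1) : ℝ × ℝ × ℝ) =
      ((1 : ℝ →L[ℝ] ℝ).smulRight (P.vectorField rotGen (γ x.1) : ℝ × ℝ × ℝ)) (1 : ℝ) := by simp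
    have he : ((1, 0, 0) : ℝ × ℝ × ℝ) =
      ((1 : ℝ →L[ℝ] ℝ).smulRight ((1, 0, 0) : ℝ × ℝ × ℝ)) (1 : ℝ) := by simp
    have hf : mfderiv I3 I3 Φ x ((1, 0, 0) : ℝ × ℝ × ℝ) =
        mfderiv I3 I3 (fun e => P.act e x.2) (γ x.1) (P.vectorField rotGen (γ x.1)) := by
      rw [he]
      refine Eq.trans hc ?_
      exact congrArg (mfderiv I3 I3 (fun e => P.act e x.2) (γ x.1)) hd.symm
    have hg := P.equivariant x.2 (γ x.1) (P.vectorField rotGen (γ x.1))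
    have hi : P.Ω (γ x.1) (P.vectorField rotGen (γ x.1)) = rotGen :=
      (P.Ω (γ x.1)).apply_symm_apply rotGen
    rw [hi] at hg
    rw [← hg]
    exact congrArg (fun w => (P.Ω (Φ x) w : Matrix (Fin 2) (Fin 2) ℝ)) hf
  -- A vector `(0, w)` is vertical, so its value `B` lies in the Lie algebra of the structure group
  -- and both flows of `B` are right multiplication by `exp (t B)`.
  have h2 (w : ℝ × ℝ) : D (0, w) = UCBundle.form x (0, w) := by
    set B := UCBundle.form x (0, w) with hB
    have hB0 : (B : Matrix (Fin 2) (Fin 2) ℝ) 1 0 = 0 := by simp [hB, UCBundle.form]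
    let c : ℝ → UCBundle := fun t =>
      (x.1, x.2 * StructureGroup.exp (t • (B : Matrix (Fin 2) (Fin 2) ℝ)))
    have hc0 : c 0 = x := by simp [c]
    have ha := UCBundle.flow hB0 x 0
    have hb : IsMIntegralCurve (I := I3) (Φ ∘ c) (P.vectorField B) := by
      have : Φ ∘ c = fun t =>
          P.act (Φ x) (StructureGroup.exp (t • (B : Matrix (Fin 2) (Fin 2) ℝ))) :=
        funext fun t => P.act_mul _ _ _
      rw [this]
      exact P.flow B hB0 (Φ x)
    have hd := HasMFDerivAt.comp 0 (g := Φ) (f := c) (hΦd (c 0)) ha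
    have he := congrArg (fun l => l (1 : ℝ)) (hasMFDerivAt_unique hd (hb 0))
    have hf : mfderiv I3 I3 Φ (c 0) ((UCBundle.form (c 0)).symm B) = P.vectorField B (Φ (c 0)) := by
      have e1 : ((UCBundle.form (c 0)).symm B : ℝ × ℝ × ℝ) =
        ((1 : ℝ →L[ℝ] ℝ).smulRight ((UCBundle.form (c 0)).symm B : ℝ × ℝ × ℝ)) (1 : ℝ) := by simp
      have e2 : (P.vectorField B (Φ (c 0)) : ℝ × ℝ × ℝ) =
        ((1 : ℝ →L[ℝ] ℝ).smulRight (P.vectorField B (Φ (c 0)) : ℝ × ℝ × ℝ)) (1 : ℝ) := by simp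
      rw [e1]
      exact he.trans e2.symm
    rw [hc0, hB, LinearEquiv.symm_apply_apply] at hf
    exact ((P.Ω (Φ x)).eq_symm_apply).1 hf
  suffices H : ∀ v : ℝ × ℝ × ℝ, D v = UCBundle.form x v from H v
  intro v
  have hv : v = v.1 • ((1, 0, 0) : ℝ × ℝ × ℝ) + (0, v.2) := by
    refine Prod.ext ?_ ?_ <;> simp
  rw [hv, map_add, map_add, map_smul, map_smul, h1, h2]

/-- The flow of the rotation field is defined for all time. -/
def IsRotComplete (P : ProjectiveConnection E C) : Prop :=
  ∀ e : E, ∃ γ : ℝ → E, γ 0 = e ∧ IsMIntegralCurve (I := I3) γ (P.vectorField rotGen)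

theorem IsComplete.isRotComplete (h : P.IsComplete) : P.IsRotComplete := h rotGen

/-- Start the curve at `e · x.2⁻¹` and shift time by `x.1`: the morphism that it spans then takes
`x` to `e`. -/
theorem IsRotComplete.exists_isMorphism (h : P.IsRotComplete) (x : UCBundle) (e : E) :
    ∃ (Φ : UCBundle → E) (f : ℝ → C), IsMorphism ucModel P Φ f ∧ Φ x = e := by
  obtain ⟨γ, h0, hγ⟩ := h (P.act e x.2⁻¹)
  have h1 := isMorphism_of_isMIntegralCurve (hγ.comp_add (-x.1))
  refine ⟨_, _, h1, ?_⟩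
  simp [h0, P.act_act_inv]

/-- Equivariance moves the coincidence to the line `(s, 1)`, an integral curve of `rotGen`;
uniqueness of integral curves spreads it along the line, and equivariance over all fibres. -/
theorem IsMorphism.eq_of_apply_eq [T2Space E] {Φ Ψ : UCBundle → E} {f k : ℝ → C}
    (hΦ : IsMorphism ucModel P Φ f) (hΨ : IsMorphism ucModel P Ψ k) {x : UCBundle}
    (hx : Φ x = Ψ x) : Φ = Ψ := by
  have hline : ∀ {Φ : UCBundle → E} {f : ℝ → C}, IsMorphism ucModel P Φ f →
      ∀ y : UCBundle, Φ y = P.act (Φ (y.1, 1)) y.2 := by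
    intro Φ f h y
    rw [← h.map_act]
    change Φ y = Φ (y.1, 1 * y.2)
    rw [one_mul]
  have h1 : Φ (x.1, 1) = Ψ (x.1, 1) := by
    have h2 : ((x.1, 1) : UCBundle) = ucModel.act x x.2⁻¹ := by
      change _ = (x.1, x.2 * x.2⁻¹)
      rw [mul_inv_cancel]
    rw [h2, hΦ.map_act, hΨ.map_act, hx]
  have h3 := P.integralCurve_unique (hΦ.isMIntegralCurve UCBundle.isMIntegralCurve_line)
    (hΨ.isMIntegralCurve UCBundle.isMIntegralCurve_line) (t := x.1) h1
  funext y
  rw [hline hΦ, hline hΨ]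
  exact congrArg (fun e => P.act e y.2) (congrFun h3 y.1)

theorem IsMorphism.eq_base {Φ : UCBundle → E} {f k : ℝ → C}
    (hf : IsMorphism ucModel P Φ f) (hk : IsMorphism ucModel P Φ k) : f = k := by
  funext φ
  exact (hf.proj_eq (φ, 1)).symm.trans (hk.proj_eq (φ, 1))

end
end ProjectiveConnection

/-! ### Completeness and homogeneity of the model -/

instance : T2Space StructureGroup := inferInstanceAs (T2Space (ℝˣ × ℝ))

namespace UCBundle

lemma form_symm_eq (e : UCBundle) (A : sl (Fin 2) ℝ) :
    (form e).symm A = (A.1 1 0 / e.2.1, 2 * e.2.1 * (A.1 0 0 + e.2.2 * (A.1 1 0 / e.2.1)),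
      e.2.1 * A.1 0 1 + (1 + e.2.2 ^ 2) * (A.1 1 0 / e.2.1)) := rfl

end UCBundle

lemma sl_apply_one_one (A : sl (Fin 2) ℝ) : A.1 1 1 = -A.1 0 0 := by
  have h : Matrix.trace A.1 = 0 := A.2
  rw [Matrix.trace_fin_two] at h
  linarith

namespace ProjectiveConnection

/-- The integral curve of `A` through `(φ, g)` is read off from the Gram matrix of
`g * exp (t A)`. -/
theorem ucModel_isComplete : ucModel.IsComplete := by
  rintro A ⟨φ₀, g₀⟩
  have ha₀ := g₀.1.ne_zero
  set a₀ : ℝ := (g₀.1 : ℝ) with ha₀'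
  let M : ℝ → Matrix (Fin 2) (Fin 2) ℝ := fun t => g₀.toMatrix * NormedSpace.exp (t • A.1)
  have hM (t : ℝ) (i j : Fin 2) :
      HasDerivAt (fun s => M s i j) (M t i 0 * A.1 0 j + M t i 1 * A.1 1 j) t := by
    have h0 := (hasDerivAt_matrix_exp A.1 t 0 j).const_mul (g₀.toMatrix i 0)
    have h1 := (hasDerivAt_matrix_exp A.1 t 1 j).const_mul (g₀.toMatrix i 1)
    refine ((h0.add h1).congr_of_eventuallyEq (.of_forall fun s => ?_)).congr_deriv ?_
    · simp [M, Matrix.mul_apply, Fin.sum_univ_two]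
    · simp [M, Matrix.mul_apply, Fin.sum_univ_two]
      ring
  have hM0 : M 0 = g₀.toMatrix := by simp [M]
  -- The determinant is constant because `A` has trace zero.
  have hdet (t : ℝ) : M t 0 0 * M t 1 1 - M t 0 1 * M t 1 0 = a₀ := by
    have hd (s : ℝ) := ((hM s 0 0).mul (hM s 1 1)).sub ((hM s 0 1).mul (hM s 1 0))
    have hc := is_const_of_deriv_eq_zero (fun s => (hd s).differentiableAt)
      (fun s => by rw [(hd s).deriv, sl_apply_one_one]; ring) t 0
    refine hc.trans ?_
    simp [hM0, StructureGroup.toMatrix, ha₀']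
  let ρ : ℝ → ℝ := fun t => M t 0 0 * M t 0 0 + M t 1 0 * M t 1 0
  have hρ (t : ℝ) : ρ t ≠ 0 := by
    intro h
    have h0 : M t 0 0 = 0 := by nlinarith [mul_self_nonneg (M t 0 0), mul_self_nonneg (M t 1 0)]
    have h1 : M t 1 0 = 0 := by nlinarith [mul_self_nonneg (M t 0 0), mul_self_nonneg (M t 1 0)]
    have := hdet t
    rw [h0, h1] at this
    exact ha₀ (by linarith)
  -- Write `M = λ R g` with `R` a rotation and `g = !![a, b; 0, 1]`. Then `MᵀM = λ² gᵀg` and `λ² a =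
  -- det M = a₀`, so the first row of the Gram matrix is `a₀ • (a, b)`.
  let a : ℝ → ℝˣ := fun t => Units.mk0 (ρ t / a₀) (div_ne_zero (hρ t) ha₀)
  have haval (t : ℝ) : (a t : ℝ) = ρ t / a₀ := rfl
  let b : ℝ → ℝ := fun t => (M t 0 0 * M t 0 1 + M t 1 0 * M t 1 1) / a₀
  have hρd (t : ℝ) := ((hM t 0 0).mul (hM t 0 0)).add ((hM t 1 0).mul (hM t 1 0))
  have hbd (t : ℝ) := (((hM t 0 0).mul (hM t 0 1)).add ((hM t 1 0).mul (hM t 1 1))).div_const a₀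
  have hcont : Continuous fun t => A.1 1 0 / (a t : ℝ) := by
    have : Continuous ρ := continuous_iff_continuousAt.2 fun t => (hρd t).continuousAt
    simp only [haval]
    exact continuous_const.div (this.div_const _) fun t => div_ne_zero (hρ t) ha₀
  -- The lower left entry of the form is `a dφ`, so the angle is the integral of `A 1 0 / a`, and no
  -- branch of the argument has to be chosen.
  let φ : ℝ → ℝ := fun t => φ₀ + ∫ s in (0 : ℝ)..t, A.1 1 0 / (a s : ℝ)
  have hφ (t : ℝ) : HasDerivAt φ (A.1 1 0 / (a t : ℝ)) t :=
    ((hcont.integral_hasStrictDerivAt 0 t).hasDerivAt).const_add φ₀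
  refine ⟨fun t => (φ t, (a t, b t)), ?_, fun t => ?_⟩
  · refine Prod.ext (by simp [φ]) (Prod.ext (Units.ext ?_) ?_)
    · simp [haval, ρ, hM0, StructureGroup.toMatrix, ← ha₀', ha₀]
    · simp [b, hM0, StructureGroup.toMatrix, ← ha₀', ha₀]
  · have h := UCBundle.hasMFDerivAt_mk (f := fun t : ℝ => ((φ t, (a t, b t)) : UCBundle))
      (hφ t).hasFDerivAt.hasMFDerivAt ((hρd t).div_const a₀).hasFDerivAt.hasMFDerivAt
      (hbd t).hasFDerivAt.hasMFDerivAt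
    refine h.congr_mfderiv (ContinuousLinearMap.ext fun (r : ℝ) => ?_)
    have hv : ucModel.vectorField A ((φ t, (a t, b t)) : UCBundle) = _ :=
      UCBundle.form_symm_eq ((φ t, (a t, b t)) : UCBundle) A
    have hA := sl_apply_one_one A
    have hρt := hρ t
    have hdt := hdet t
    refine Prod.ext ?_ (Prod.ext ?_ ?_)
    · change r * _ = r * _
      rw [hv]
    · change r * _ = r * _
      rw [hv]
      congr 1
      simp only [haval, b]
      field_simp
      simp only [ρ]
      ring
    · change r * _ = r * _
      rw [hv]
      congr 1
      simp only [haval, b, hA]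
      field_simp
      simp only [ρ]
      rw [← hdt]
      ring

/-- The automorphisms of the model act transitively on its total space. -/
theorem exists_automorphism (x y : UCBundle) :
    ∃ (T : Equiv.Perm UCBundle) (τ : Equiv.Perm ℝ),
      IsIsomorphism ucModel ucModel T τ ∧ T x = y := by
  obtain ⟨Φ, f, h, hxy⟩ := ucModel_isComplete.isRotComplete.exists_isMorphism x y
  obtain ⟨Ψ, k, h', hyx⟩ := ucModel_isComplete.isRotComplete.exists_isMorphism y x
  have hid : IsMorphism ucModel ucModel id id :=
    ⟨contMDiff_id, contMDiff_id, fun _ => rfl, fun _ _ => rfl, fun e v => by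
      rw [mfderiv_id]; rfl⟩
  -- Each composite fixes a point, so it is the identity by `eq_of_apply_eq`.
  have h1 : Ψ ∘ Φ = id := (h.comp h').eq_of_apply_eq hid (x := x) (by simp [hxy, hyx])
  have h2 : Φ ∘ Ψ = id := (h'.comp h).eq_of_apply_eq hid (x := y) (by simp [hxy, hyx])
  have h3 : k ∘ f = id := (h1 ▸ h.comp h').eq_base hid
  have h4 : f ∘ k = id := (h2 ▸ h'.comp h).eq_base hid
  exact ⟨⟨Φ, Ψ, congrFun h1, congrFun h2⟩, ⟨f, k, congrFun h3, congrFun h4⟩, ⟨h, h'⟩, hxy⟩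

end ProjectiveConnection

/-! ### Free groups of homeomorphisms of the line -/

section Real

theorem lt_apply_of_forall_ne {τ : ℝ → ℝ} (hc : Continuous τ) (hne : ∀ x, τ x ≠ x) {a : ℝ}
    (ha : a < τ a) (x : ℝ) : x < τ x := by
  by_contra! h
  have h1 : ∃ y, τ y - y = 0 := mem_range_of_exists_le_of_exists_ge (hc.sub continuous_id)
    ⟨x, by linarith⟩ ⟨a, by linarith⟩
  obtain ⟨y, hy⟩ := h1
  exact hne y (by linarith)

/-- A decreasing map has a fixed point: `τ x - x` has opposite signs at `0` and at `τ 0`. -/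
theorem strictMono_of_forall_ne {τ : ℝ → ℝ} (hc : Continuous τ) (hi : Function.Injective τ)
    (hne : ∀ x, τ x ≠ x) : StrictMono τ := by
  refine (hc.strictMono_of_inj hi).resolve_right fun hanti => ?_
  rcases lt_or_gt_of_ne (hne 0) with h | h
  · have h1 := hanti h
    have : ∃ y, τ y - y = 0 := mem_range_of_exists_le_of_exists_ge (hc.sub continuous_id)
      ⟨0, by linarith⟩ ⟨τ 0, by linarith⟩
    obtain ⟨y, hy⟩ := this
    exact hne y (by linarith)
  · have h1 := hanti h
    have : ∃ y, τ y - y = 0 := mem_range_of_exists_le_of_exists_ge (hc.sub continuous_id)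
      ⟨τ 0, by linarith⟩ ⟨0, by linarith⟩
    obtain ⟨y, hy⟩ := this
    exact hne y (by linarith)

/-- A bounded increasing orbit would converge to a fixed point. -/
theorem exists_lt_iterate {τ : ℝ → ℝ} (hc : Continuous τ) (hlt : ∀ x, x < τ x) (a y : ℝ) :
    ∃ n : ℕ, y < τ^[n] a := by
  by_contra! h
  have hm : Monotone fun n => τ^[n] a := monotone_nat_of_le_succ fun n => by
    rw [Function.iterate_succ_apply']
    exact (hlt _).le
  have ht := tendsto_atTop_ciSup hm ⟨y, by rintro _ ⟨n, rfl⟩; exact h n⟩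
  exact (hlt _).ne' (isFixedPt_of_tendsto_iterate ht hc.continuousAt)

/-- A free group of homeomorphisms of the line with a discrete orbit is cyclic. -/
theorem exists_generator_of_free (Γ : Subgroup (Equiv.Perm ℝ)) (hc : ∀ τ ∈ Γ, Continuous τ)
    (hfree : ∀ τ ∈ Γ, ∀ x, τ x = x → τ = 1)
    (hclosed : IsClosed {x : ℝ | ∃ τ ∈ Γ, τ 0 = x}) {ε : ℝ} (hε : 0 < ε)
    (hdisc : ∀ τ ∈ Γ, |τ 0| < ε → τ = 1) :
    Γ = ⊥ ∨ ∃ τ ∈ Γ, (∀ x, x < τ x) ∧ ∀ σ ∈ Γ, ∃ k : ℤ, τ ^ k = σ := by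
  rw [or_iff_not_imp_left]
  intro hΓ
  have hne : ∀ τ ∈ Γ, τ ≠ 1 → ∀ x, τ x ≠ x := fun τ hτ h1 x hx => h1 (hfree τ hτ x hx)
  have hmono : ∀ τ ∈ Γ, StrictMono τ := by
    intro τ hτ
    by_cases h1 : τ = 1
    · subst h1; exact strictMono_id
    · exact strictMono_of_forall_ne (hc τ hτ) τ.injective (hne τ hτ h1)
  -- The generator is the element that moves `0` least to the right. Since the orbit is closed the
  -- infimum is attained, and `ε` keeps it away from `0`.
  let S : Set ℝ := {x | ∃ τ ∈ Γ, τ 0 = x} ∩ Set.Ici ε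
  have hSne : S.Nonempty := by
    obtain ⟨τ, hτ, h1⟩ := Γ.bot_or_exists_ne_one.resolve_left hΓ
    rcases lt_or_gt_of_ne (hne τ hτ h1 0) with h | h
    · have h2 : 0 < τ⁻¹ 0 := by
        have := hmono τ⁻¹ (Γ.inv_mem hτ) h
        rwa [← Equiv.Perm.mul_apply, inv_mul_cancel, Equiv.Perm.one_apply] at this
      refine ⟨τ⁻¹ 0, ⟨τ⁻¹, Γ.inv_mem hτ, rfl⟩, ?_⟩
      by_contra! h3
      exact h1 (inv_eq_one.1 (hdisc τ⁻¹ (Γ.inv_mem hτ) (by rw [abs_of_pos h2]; simpa using h3)))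
    · refine ⟨τ 0, ⟨τ, hτ, rfl⟩, ?_⟩
      by_contra! h3
      exact h1 (hdisc τ hτ (by rw [abs_of_pos h]; simpa using h3))
  have hbdd : BddBelow S := ⟨ε, fun x hx => hx.2⟩
  obtain ⟨⟨τ, hτ, hτ0⟩, hs⟩ := (hclosed.inter isClosed_Ici).csInf_mem hSne hbdd
  have hpos : 0 < τ 0 := by rw [hτ0]; exact hε.trans_le hs
  have hτ1 : τ ≠ 1 := by rintro rfl; exact hpos.ne rfl
  have hlt := lt_apply_of_forall_ne (hc τ hτ) (hne τ hτ hτ1) hpos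
  have hlt' : ∀ x, τ⁻¹ x < x := fun x => by
    have := hlt (τ⁻¹ x)
    rwa [← Equiv.Perm.mul_apply, mul_inv_cancel, Equiv.Perm.one_apply] at this
  refine ⟨τ, hτ, hlt, fun σ hσ => ?_⟩
  have hstep : ∀ k : ℤ, (τ ^ k) 0 < (τ ^ (k + 1)) 0 := by
    intro k
    rw [add_comm, _root_.zpow_add, zpow_one]
    exact hlt _
  have hz : StrictMono fun k : ℤ => (τ ^ k) 0 := strictMono_int_of_lt_succ hstep
  obtain ⟨n, hn⟩ := exists_lt_iterate (hc τ hτ) hlt 0 (σ 0)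
  have hlow : ∃ k : ℤ, (τ ^ k) 0 ≤ σ 0 := by
    by_contra! h
    have hanti : Antitone fun m : ℕ => (⇑(τ⁻¹ : Equiv.Perm ℝ))^[m] 0 :=
        antitone_nat_of_succ_le fun m => by
      rw [Function.iterate_succ_apply']
      exact (hlt' _).le
    have hb : ∀ m : ℕ, σ 0 ≤ (⇑(τ⁻¹ : Equiv.Perm ℝ))^[m] 0 := fun m => by
      have := h (-m)
      rw [_root_.zpow_neg, zpow_natCast, ← inv_pow, ← Equiv.Perm.iterate_eq_pow] at this
      exact this.le
    have ht := tendsto_atTop_ciInf hanti ⟨σ 0, by rintro _ ⟨m, rfl⟩; exact hb m⟩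
    exact (hlt' _).ne (isFixedPt_of_tendsto_iterate ht (hc τ⁻¹ (Γ.inv_mem hτ)).continuousAt)
  obtain ⟨k, hk, hmax⟩ := Int.exists_greatest_of_bdd (P := fun k => (τ ^ k) 0 ≤ σ 0)
    ⟨n, fun z hzle => by
      by_contra! hcon
      have h1 := hz hcon
      simp only [zpow_natCast] at h1
      rw [← Equiv.Perm.iterate_eq_pow] at h1
      linarith⟩ hlow
  refine ⟨k, ?_⟩
  have hk1 : σ 0 < (τ ^ (k + 1)) 0 := by
    by_contra! hcon
    have := hmax _ hcon
    omega
  -- Division with remainder: `ρ` moves `0` into `[0, τ 0)`, so by minimality of `τ 0` it is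
  -- trivial.
  let ρ := (τ ^ k)⁻¹ * σ
  have hkΓ : τ ^ k ∈ Γ := Γ.zpow_mem hτ k
  have hρ : ρ ∈ Γ := Γ.mul_mem (Γ.inv_mem hkΓ) hσ
  have hρ0 : 0 ≤ ρ 0 := by
    have := (hmono _ (Γ.inv_mem hkΓ)).monotone hk
    rwa [← Equiv.Perm.mul_apply, inv_mul_cancel, Equiv.Perm.one_apply] at this
  have hρ2 : ρ 0 < τ 0 := by
    have := hmono _ (Γ.inv_mem hkΓ) hk1
    rwa [_root_.zpow_add, ← Equiv.Perm.mul_apply, ← Equiv.Perm.mul_apply, inv_mul_cancel_left,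
      zpow_one] at this
  have hρ1 : ρ = 1 := by
    by_contra hne1
    have hmem : ρ 0 ∈ S := by
      refine ⟨⟨ρ, hρ, rfl⟩, ?_⟩
      by_contra! h3
      exact hne1 (hdisc ρ hρ (by rw [abs_of_nonneg hρ0]; simpa using h3))
    have := csInf_le hbdd hmem
    rw [← hτ0] at this
    linarith
  exact (inv_mul_eq_one.1 hρ1)

end Real

/-! ### The base map of a morphism from the model, and its deck group -/

instance : IsTopologicalGroup StructureGroup where
  continuous_mul := by
    have h : Continuous fun p : (ℝˣ × ℝ) × (ℝˣ × ℝ) =>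
        ((p.1.1 * p.2.1, p.1.1 * p.2.2 + p.1.2) : ℝˣ × ℝ) := by fun_prop
    exact h
  continuous_inv := by
    have h : Continuous fun p : ℝˣ × ℝ => ((p.1⁻¹, -((p.1⁻¹ : ℝˣ) * p.2)) : ℝˣ × ℝ) := by fun_prop
    exact h

namespace ProjectiveConnection

section
variable {E : Type*} [TopologicalSpace E] [ChartedSpace Model3 E] [IsManifold I3 ∞ E]
  {C : Type*} [TopologicalSpace C] [ChartedSpace ℝ C]
  {P : ProjectiveConnection E C}

theorem isOpenMap_proj (P : ProjectiveConnection E C) : IsOpenMap P.proj := by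
  rw [isOpenMap_iff_nhds_le]
  intro e W hW
  obtain ⟨U, hUo, hU, σ, τ, hσ, -, h1, h2⟩ := P.locally_trivial (P.proj e)
  have hc : ContinuousAt (fun x => P.act (σ x) (τ e)) (P.proj e) :=
    (P.contMDiff_act_right (τ e)).continuous.continuousAt.comp
      ((hσ _ hU).continuousWithinAt.continuousAt (hUo.mem_nhds hU))
  have hW' : P.proj ⁻¹' W ∈ nhds (P.act (σ (P.proj e)) (τ e)) := by rwa [h2 e hU]
  filter_upwards [hc hW', hUo.mem_nhds hU] with x hx hxU
  have := (h1 x hxU (τ e)).1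
  rwa [Set.mem_preimage, Set.mem_preimage, this] at hx

/-- The difference of two points of the same fibre depends continuously on them. -/
theorem exists_continuousAt_act_eq (P : ProjectiveConnection E C) (e : E) :
    ∃ G : E × E → StructureGroup, ContinuousAt G (e, e) ∧ G (e, e) = 1 ∧
      ∀ᶠ p in nhds (e, e), P.proj p.1 = P.proj p.2 → P.act p.1 (G p) = p.2 := by
  obtain ⟨U, hUo, hU, σ, τ, -, hτ, h1, h2⟩ := P.locally_trivial (P.proj e)
  have hV : P.proj ⁻¹' U ∈ nhds e := P.contMDiff_proj.continuous.continuousAt (hUo.mem_nhds hU)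
  have hτc : ContinuousAt τ e := (hτ e hU).continuousWithinAt.continuousAt hV
  refine ⟨fun p => (τ p.1)⁻¹ * τ p.2, ?_, inv_mul_cancel _, ?_⟩
  · exact ((hτc.comp (x := (e, e)) continuousAt_fst).inv).mul
      (hτc.comp (x := (e, e)) continuousAt_snd)
  · filter_upwards [prod_mem_nhds hV hV] with p hp h
    have e1 := h2 _ hp.1
    have e2 := h2 _ hp.2
    calc P.act p.1 ((τ p.1)⁻¹ * τ p.2)
        = P.act (P.act (σ (P.proj p.1)) (τ p.1)) ((τ p.1)⁻¹ * τ p.2) := by rw [e1]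
      _ = p.2 := by rw [← P.act_mul, mul_inv_cancel_left, h, e2]

variable {Φ : UCBundle → E} {f : ℝ → C}

namespace IsMorphism

theorem isOpenMap_base (h : IsMorphism ucModel P Φ f) : IsOpenMap f := by
  intro W hW
  have h1 : f '' W = P.proj '' (Φ '' (Prod.fst ⁻¹' W)) := by
    ext c
    constructor
    · rintro ⟨φ, hφ, rfl⟩
      exact ⟨_, ⟨(φ, 1), hφ, rfl⟩, h.proj_eq (φ, 1)⟩
    · rintro ⟨_, ⟨x, hx, rfl⟩, rfl⟩
      exact ⟨x.1, hx, (h.proj_eq x).symm⟩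
  rw [h1]
  exact P.isOpenMap_proj _ (h.isLocalDiffeomorph.isOpenMap _ (hW.preimage continuous_fst))

/-- If `f a = f b` with `a`, `b` near `φ₀`, then `Φ (a, g) = Φ (b, 1)` for some `g`, which is near
`1` because the difference of points in a fibre is continuous. Local injectivity of `Φ` at `(φ₀, 1)`
then gives `a = b`. -/
theorem exists_injOn_base (h : IsMorphism ucModel P Φ f) (φ₀ : ℝ) :
    ∃ U ∈ nhds φ₀, Set.InjOn f U := by
  obtain ⟨Ψ, hΨ, hΨe⟩ := h.isLocalDiffeomorph ((φ₀, 1) : UCBundle)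
  have hinj : Set.InjOn Φ Ψ.source := by
    intro x hx y hy hxy
    rw [hΨe hx, hΨe hy] at hxy
    exact Ψ.injOn hx hy hxy
  have hW : Ψ.source ∈ nhds ((φ₀, 1) : UCBundle) := Ψ.open_source.mem_nhds hΨ
  obtain ⟨G, hG, hG1, hGact⟩ := P.exists_continuousAt_act_eq (Φ (φ₀, 1))
  have hl : Continuous fun s : ℝ => Φ (s, 1) :=
    h.contMDiff.continuous.comp (Continuous.prodMk_left 1)
  let l : ℝ × ℝ → E × E := fun p => (Φ (p.1, 1), Φ (p.2, 1))
  have hlc : ContinuousAt l (φ₀, φ₀) :=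
    ((hl.comp continuous_fst).prodMk (hl.comp continuous_snd)).continuousAt
  have hGl : ContinuousAt (G ∘ l) (φ₀, φ₀) := ContinuousAt.comp (x := (φ₀, φ₀)) hG hlc
  have h1 : ContinuousAt (fun p : ℝ × ℝ => ((p.1, G (l p)) : UCBundle)) (φ₀, φ₀) :=
    continuousAt_fst.prodMk hGl
  have h2 : ContinuousAt (fun p : ℝ × ℝ => ((p.2, 1) : UCBundle)) (φ₀, φ₀) :=
    continuousAt_snd.prodMk continuousAt_const
  have hev : ∀ᶠ p : ℝ × ℝ in nhds (φ₀, φ₀), f p.1 = f p.2 → p.1 = p.2 := by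
    have h1' := h1.preimage_mem_nhds (t := Ψ.source) (by
      change Ψ.source ∈ nhds ((φ₀, G (Φ (φ₀, 1), Φ (φ₀, 1))) : UCBundle)
      rwa [hG1])
    filter_upwards [h1', h2.preimage_mem_nhds hW, hlc.eventually hGact] with p a b c hf
    have hp : P.proj (l p).1 = P.proj (l p).2 :=
      (h.proj_eq (p.1, 1)).trans (hf.trans (h.proj_eq (p.2, 1)).symm)
    have hc := c hp
    have : Φ (p.1, G (l p)) = Φ (p.2, 1) := by
      refine Eq.trans ?_ hc
      rw [← h.map_act]
      change _ = Φ (p.1, 1 * G (l p))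
      rw [one_mul]
    exact congrArg Prod.fst (hinj a b this)
  rw [nhds_prod_eq] at hev
  obtain ⟨U, hU, hU'⟩ := (Filter.eventually_prod_self_iff (r := fun a b => f a = f b → a = b)).1 hev
  exact ⟨U, hU, fun x hx y hy hxy => hU' x hx y hy hxy⟩

variable [T2Space E]

/-- By homogeneity some automorphism takes `y` to `x`; composed with `Φ` it agrees with `Ψ` at `y`,
hence everywhere. -/
theorem exists_automorphism_of_apply_eq {E' : Type*} [TopologicalSpace E']
    [ChartedSpace Model3 E'] [IsManifold I3 ∞ E'] {C' : Type*} [TopologicalSpace C']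
    [ChartedSpace ℝ C'] [T2Space E'] {P' : ProjectiveConnection E' C'}
    {Φ Ψ : UCBundle → E'} {f k : ℝ → C'} (h : IsMorphism ucModel P' Φ f)
    (h' : IsMorphism ucModel P' Ψ k) {x y : UCBundle} (hxy : Φ x = Ψ y) :
    ∃ (T : Equiv.Perm UCBundle) (τ : Equiv.Perm ℝ), IsIsomorphism ucModel ucModel T τ ∧
      T y = x ∧ Φ ∘ T = Ψ ∧ f ∘ τ = k := by
  obtain ⟨T, τ, hT, hyx⟩ := exists_automorphism y x
  have h1 : Φ ∘ T = Ψ := (hT.hom.comp h).eq_of_apply_eq h' (x := y) (by simp [hyx, hxy])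
  exact ⟨T, τ, hT, hyx, h1, (h1 ▸ hT.hom.comp h).eq_base h'⟩

/-- The range of `f` is open. It is also closed: through each point of `C` passes the base map of
some morphism `k`, and if the ranges of `k` and `f` met, the two would differ by an automorphism and
have the same range. -/
theorem surjective (h : IsMorphism ucModel P Φ f) [PreconnectedSpace C] (hP : P.IsRotComplete) :
    Function.Surjective Φ := by
  refine h.surjective_of_base ?_
  have hcl : IsClosed (Set.range f) := by
    rw [← isOpen_compl_iff, isOpen_iff_mem_nhds]
    intro c hc
    obtain ⟨e, rfl⟩ := P.proj_surjective c
    obtain ⟨Ψ, k, hk, hΨ⟩ := hP.exists_isMorphism (0, 1) e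
    have hmem : Set.range k ∈ nhds (P.proj e) :=
      hk.isOpenMap_base.isOpen_range.mem_nhds ⟨0, by rw [← hΨ]; exact (hk.proj_eq (0, 1)).symm⟩
    filter_upwards [hmem]
    rintro _ ⟨s, rfl⟩ ⟨φ, hφ⟩
    have h1 : P.proj (Φ (φ, 1)) = P.proj (Ψ (s, 1)) :=
      (h.proj_eq (φ, 1)).trans (hφ.trans (hk.proj_eq (s, 1)).symm)
    obtain ⟨g, hg⟩ := P.exists_act_eq h1
    rw [← h.map_act] at hg
    obtain ⟨T, τ, -, -, -, h2⟩ := h.exists_automorphism_of_apply_eq hk hg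
    refine hc ⟨τ 0, ?_⟩
    have h3 := congrFun h2 0
    have h4 := (hk.proj_eq (0, 1))
    rw [hΨ] at h4
    exact h3.trans h4.symm
  have hcl' : IsClopen (Set.range f) := ⟨hcl, h.isOpenMap_base.isOpen_range⟩
  exact Set.range_eq_univ.1 (hcl'.eq_univ ⟨f 0, 0, rfl⟩)

end IsMorphism

/-- The pairs of an automorphism of the model and its base map that preserve `Φ`. -/
def deckGroup (Φ : UCBundle → E) : Subgroup (Equiv.Perm UCBundle × Equiv.Perm ℝ) where
  carrier := {p | IsIsomorphism ucModel ucModel p.1 p.2 ∧ ∀ x, Φ (p.1 x) = Φ x}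
  mul_mem' := by
    rintro p q ⟨hp, hp'⟩ ⟨hq, hq'⟩
    exact ⟨hq.trans hp, fun x => (hp' _).trans (hq' x)⟩
  one_mem' := by
    have hid : IsMorphism ucModel ucModel id id :=
      ⟨contMDiff_id, contMDiff_id, fun _ => rfl, fun _ _ => rfl, fun e v => by
        rw [mfderiv_id]; rfl⟩
    exact ⟨⟨hid, hid⟩, fun x => rfl⟩
  inv_mem' := by
    rintro p ⟨hp, hp'⟩
    refine ⟨hp.symm, fun x => ?_⟩
    have := hp' (p.1⁻¹ x)
    rw [← Equiv.Perm.mul_apply, mul_inv_cancel, Equiv.Perm.one_apply] at this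
    exact this.symm

namespace IsMorphism

variable (h : IsMorphism ucModel P Φ f)
include h

theorem base_deck {p : Equiv.Perm UCBundle × Equiv.Perm ℝ} (hp : p ∈ deckGroup Φ) (φ : ℝ) :
    f (p.2 φ) = f φ := by
  have h1 := hp.1.hom.proj_eq (φ, 1)
  have h2 := h.proj_eq (p.1 (φ, 1))
  rw [hp.2, h.proj_eq] at h2
  exact (h2.trans (congrArg f h1)).symm

/-- Freeness. If `p` fixes `φ` on the base, it moves `(φ, 1)` within its fibre by some `g`.
Invariance of `Φ` and freeness of the action on `E` force `g = 1`, so `p` fixes a point of the total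
space. -/
theorem deck_eq_one {p : Equiv.Perm UCBundle × Equiv.Perm ℝ} (hp : p ∈ deckGroup Φ) {φ : ℝ}
    (hφ : p.2 φ = φ) : p = 1 := by
  have h1 : (p.1 (φ, 1)).1 = φ := (hp.1.hom.proj_eq (φ, 1)).trans hφ
  have h2 : p.1 (φ, 1) = ucModel.act (φ, 1) (p.1 (φ, 1)).2 := by
    change _ = (φ, 1 * (p.1 (φ, 1)).2)
    rw [one_mul]
    exact Prod.ext h1 rfl
  have h3 := hp.2 (φ, 1)
  rw [h2, h.map_act] at h3
  have h4 : (p.1 (φ, 1)).2 = 1 := P.act_injective _ (h3.trans (P.act_one _).symm)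
  rw [h4, ucModel.act_one] at h2
  have hid : IsIsomorphism ucModel ucModel (1 : Equiv.Perm UCBundle) (1 : Equiv.Perm ℝ) :=
    (deckGroup Φ).one_mem.1
  have h5 := hp.1.hom.eq_of_apply_eq hid.hom h2
  have h6 : ((p.2 : ℝ → ℝ)) = (1 : Equiv.Perm ℝ) := (h5 ▸ hp.1.hom).eq_base hid.hom
  exact Prod.ext (DFunLike.coe_injective h5) (DFunLike.coe_injective h6)

variable [T2Space E]

theorem exists_deck {x y : UCBundle} (hxy : Φ x = Φ y) :
    ∃ p ∈ deckGroup Φ, p.1 y = x := by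
  obtain ⟨T, τ, hT, hyx, h1, -⟩ := h.exists_automorphism_of_apply_eq h hxy
  exact ⟨(T, τ), ⟨hT, congrFun h1⟩, hyx⟩

theorem exists_deck_base {a b : ℝ} (hab : f a = f b) : ∃ p ∈ deckGroup Φ, p.2 b = a := by
  have h1 : P.proj (Φ (a, 1)) = P.proj (Φ (b, 1)) :=
    (h.proj_eq (a, 1)).trans (hab.trans (h.proj_eq (b, 1)).symm)
  obtain ⟨g, hg⟩ := P.exists_act_eq h1
  rw [← h.map_act] at hg
  obtain ⟨p, hp, hpy⟩ := h.exists_deck hg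
  refine ⟨p, hp, ?_⟩
  have h2 := hp.1.hom.proj_eq (b, 1)
  rw [hpy] at h2
  exact h2.symm

/-- The fibres of `f` are the deck orbits. A neighbourhood on which `f` is injective misses its
nontrivial translates: if `u` and `p u` both lie in it then `p u = u`, and `p` is trivial by
freeness. -/
theorem isCoveringMap (hs : Function.Surjective Φ) : IsCoveringMap f := by
  let Γ : Subgroup (Equiv.Perm ℝ) := (deckGroup Φ).map (MonoidHom.snd _ _)
  have hq : IsQuotientCoveringMap f Γ :=
    { toIsQuotientMap := h.isOpenMap_base.isQuotientMap h.contMDiff_base.continuous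
        (h.surjective_base hs)
      continuous_const_smul := by
        rintro ⟨_, p, hp, rfl⟩
        exact hp.1.hom.contMDiff_base.continuous
      apply_eq_iff_mem_orbit := by
        intro a b
        constructor
        · intro hab
          obtain ⟨p, hp, hpb⟩ := h.exists_deck_base hab
          exact ⟨⟨p.2, p, hp, rfl⟩, hpb⟩
        · rintro ⟨⟨_, p, hp, rfl⟩, rfl⟩
          exact h.base_deck hp b
      disjoint := by
        intro φ
        obtain ⟨U, hU, hinj⟩ := h.exists_injOn_base φ
        refine ⟨U, hU, ?_⟩
        rintro ⟨_, p, hp, rfl⟩ ⟨_, ⟨u, hu, rfl⟩, hv⟩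
        have h1 : p.2 u = u := hinj hv hu (h.base_deck hp u)
        have := h.deck_eq_one hp h1
        exact Subtype.ext (congrArg Prod.snd this) }
  exact hq.isCoveringMap

/-- The deck group of a morphism from the model is trivial or generated by one element, which
acts without fixed points. -/
theorem deckGroup_cyclic [T2Space C] :
    (∀ p ∈ deckGroup Φ, p = 1) ∨ ∃ p ∈ deckGroup Φ, (∀ φ, φ < p.2 φ) ∧
      ∀ q ∈ deckGroup Φ, ∃ k : ℤ, p ^ k = q := by
  let Γ : Subgroup (Equiv.Perm ℝ) := (deckGroup Φ).map (MonoidHom.snd _ _)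
  -- The orbit of `0` is a fibre of `f`, hence closed; local injectivity of `f` at `0` supplies `ε`.
  have hset : {x : ℝ | ∃ τ ∈ Γ, τ 0 = x} = f ⁻¹' {f 0} := by
    ext x
    constructor
    · rintro ⟨_, ⟨p, hp, rfl⟩, rfl⟩
      exact h.base_deck hp 0
    · intro hx
      obtain ⟨p, hp, hp0⟩ := h.exists_deck_base (hx : f x = f 0)
      exact ⟨_, ⟨p, hp, rfl⟩, hp0⟩
  obtain ⟨U, hU, hinj⟩ := h.exists_injOn_base 0
  obtain ⟨ε, hε, hεU⟩ := Metric.mem_nhds_iff.1 hU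
  have hfree : ∀ τ ∈ Γ, ∀ x, τ x = x → τ = 1 := by
    rintro _ ⟨p, hp, rfl⟩ x hx
    exact congrArg Prod.snd (h.deck_eq_one hp hx)
  rcases exists_generator_of_free Γ
    (by rintro _ ⟨p, hp, rfl⟩; exact hp.1.hom.contMDiff_base.continuous) hfree
    (by rw [hset]; exact isClosed_singleton.preimage h.contMDiff_base.continuous) hε
    (by
      rintro _ ⟨p, hp, rfl⟩ hlt
      have h1 : p.2 0 = 0 := hinj (hεU (by simpa using hlt)) (hεU (by simpa using hε))
        (h.base_deck hp 0)
      exact congrArg Prod.snd (h.deck_eq_one hp h1)) with h0 | ⟨_, ⟨p, hp, rfl⟩, hlt, hgen⟩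
  · left
    intro p hp
    have : p.2 ∈ Γ := ⟨p, hp, rfl⟩
    rw [h0, Subgroup.mem_bot] at this
    exact h.deck_eq_one hp (φ := 0) (by rw [this]; rfl)
  · right
    refine ⟨p, hp, hlt, fun q hq => ?_⟩
    obtain ⟨k, hk⟩ := hgen q.2 ⟨q, hq, rfl⟩
    refine ⟨k, ?_⟩
    have h1 : q⁻¹ * p ^ k ∈ deckGroup Φ :=
      (deckGroup Φ).mul_mem ((deckGroup Φ).inv_mem hq) ((deckGroup Φ).zpow_mem hp k)
    have h2 : (q⁻¹ * p ^ k).2 0 = 0 := by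
      have : (q⁻¹ * p ^ k).2 = 1 := by
        rw [Prod.snd_mul, Prod.snd_inv, Prod.pow_snd]
        exact inv_mul_eq_one.2 hk.symm
      rw [this]; rfl
    exact (inv_mul_eq_one.1 (h.deck_eq_one h1 h2)).symm

end IsMorphism
end
end ProjectiveConnection

/-! ### Rotations, frames and developing maps -/

/-- The rotation of angle `φ`. -/
def rotMatrix (φ : ℝ) : Matrix (Fin 2) (Fin 2) ℝ :=
  !![Real.cos φ, -Real.sin φ; Real.sin φ, Real.cos φ]

lemma rotMatrix_add (φ ψ : ℝ) : rotMatrix (φ + ψ) = rotMatrix φ * rotMatrix ψ := by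
  ext i j
  fin_cases i <;> fin_cases j <;>
    simp [rotMatrix, Matrix.mul_apply, Fin.sum_univ_two, Real.cos_add, Real.sin_add] <;> ring

lemma rotMatrix_zero : rotMatrix 0 = 1 := by
  ext i j
  fin_cases i <;> fin_cases j <;> simp [rotMatrix]

/-- The rotation of angle `φ` as an element of `GL(2, ℝ)`. -/
def rotGL (φ : ℝ) : GL (Fin 2) ℝ where
  val := rotMatrix φ
  inv := rotMatrix (-φ)
  val_inv := by rw [← rotMatrix_add, add_neg_cancel, rotMatrix_zero]
  inv_val := by rw [← rotMatrix_add, neg_add_cancel, rotMatrix_zero]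

@[simp] lemma coe_rotGL (φ : ℝ) : (rotGL φ : Matrix (Fin 2) (Fin 2) ℝ) = rotMatrix φ := rfl

@[simp] lemma rotGL_zero : rotGL 0 = 1 := Units.ext rotMatrix_zero

lemma basePoint_smul_toPGL (g : StructureGroup) : g.toPGL • basePoint = basePoint := by
  have : g.toPGL ∈ MulAction.stabilizer PGL(2, ℝ) basePoint := by
    rw [← StructureGroup.range_toPGL]
    exact ⟨g, rfl⟩
  exact this

lemma mk_rotGL_smul_basePoint (φ : ℝ) : ProjGenLinGroup.mk (rotGL φ) • basePoint = ucProj φ := by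
  rw [basePoint, Projectivization.PGL.mk_smul_mk, ucProj, Projectivization.mk_eq_mk_iff']
  refine ⟨1, ?_⟩
  ext i
  fin_cases i <;> simp [rotMatrix]

lemma mk_eq_ucProj (v : Fin 2 → ℝ) (hv : v ≠ 0) :
    ∃ φ, Projectivization.mk ℝ v hv = ucProj φ := by
  let z : ℂ := ⟨v 0, v 1⟩
  have hz : z ≠ 0 := by
    intro h
    refine hv ?_
    have h0 : v 0 = 0 := congrArg Complex.re h
    have h1 : v 1 = 0 := congrArg Complex.im h
    ext i
    fin_cases i <;> simp [h0, h1]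
  have hn : ‖z‖ ≠ 0 := norm_ne_zero_iff.2 hz
  refine ⟨z.arg, ?_⟩
  rw [ucProj, Projectivization.mk_eq_mk_iff']
  refine ⟨‖z‖, ?_⟩
  ext i
  fin_cases i
  · change ‖z‖ * Real.cos z.arg = z.re
    rw [Complex.cos_arg hz]
    field_simp
  · change ‖z‖ * Real.sin z.arg = z.im
    rw [Complex.sin_arg]
    field_simp

lemma ucProj_surjective : Function.Surjective ucProj := by
  intro p
  induction p using Projectivization.ind with | h v hv =>
  obtain ⟨φ, h⟩ := mk_eq_ucProj v hv
  exact ⟨φ, h.symm⟩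

lemma ucProj_eq_iff (φ ψ : ℝ) : ucProj φ = ucProj ψ ↔ ∃ k : ℤ, φ = ψ + k * Real.pi := by
  rw [ucProj, ucProj, Projectivization.mk_eq_mk_iff']
  constructor
  · rintro ⟨c, hc⟩
    have h0 := congrFun hc 0
    have h1 := congrFun hc 1
    simp at h0 h1
    have : Real.sin (φ - ψ) = 0 := by rw [Real.sin_sub, ← h0, ← h1]; ring
    obtain ⟨k, hk⟩ := Real.sin_eq_zero_iff.1 this
    exact ⟨k, by linarith⟩
  · rintro ⟨k, rfl⟩
    refine ⟨(-1) ^ k, ?_⟩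
    ext i
    fin_cases i
    · simp [Real.cos_add_int_mul_pi]
    · simp [Real.sin_add_int_mul_pi]

/-- The element of `PGL(2, ℝ)` for which a point of the model bundle stands. -/
def stdFrame (x : UCBundle) : PGL(2, ℝ) := ProjGenLinGroup.mk (rotGL x.1) * x.2.toPGL

lemma exists_stdFrame_eq {h : PGL(2, ℝ)} {φ : ℝ} (hφ : h • basePoint = ucProj φ) :
    ∃ g, stdFrame (φ, g) = h := by
  have : (ProjGenLinGroup.mk (rotGL φ))⁻¹ * h ∈ StructureGroup.toPGL.range := by
    rw [StructureGroup.range_toPGL, MulAction.mem_stabilizer_iff, mul_smul, hφ,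
      ← mk_rotGL_smul_basePoint, inv_smul_smul]
  obtain ⟨g, hg⟩ := this
  exact ⟨g, by rw [stdFrame, hg, mul_inv_cancel_left]⟩

lemma stdFrame_surjective : Function.Surjective stdFrame := by
  intro h
  obtain ⟨φ, hφ⟩ := ucProj_surjective (h • basePoint)
  obtain ⟨g, hg⟩ := exists_stdFrame_eq hφ.symm
  exact ⟨_, hg⟩

namespace UCBundle

/-- A representative of the standard frame with trace free logarithmic derivative. -/
def lift (x : UCBundle) : Matrix (Fin 2) (Fin 2) ℝ :=
  -- `Real.log` is even, so the factor is `|a| ^ (-1/2)` for either sign of `a`, and the determinant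
  -- of the lift is `±1`.
  Real.exp (-(Real.log (x.2.1 : ℝ) / 2)) • (rotMatrix x.1 * x.2.toMatrix)

/-- The standard lift to `GL(2, ℝ)` of the standard frame. -/
def liftGL (x : UCBundle) : GL (Fin 2) ℝ :=
  (rotGL x.1 * x.2.toGL) * Matrix.GeneralLinearGroup.scalar (Fin 2)
    (Units.mk0 _ (Real.exp_ne_zero (-(Real.log (x.2.1 : ℝ) / 2))))

lemma coe_liftGL (x : UCBundle) : (liftGL x : Matrix (Fin 2) (Fin 2) ℝ) = lift x := by
  simp [liftGL, lift, smul_eq_mul_diagonal]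

lemma stdFrame_eq_mk (x : UCBundle) : stdFrame x = ProjGenLinGroup.mk (liftGL x) := by
  rw [stdFrame, StructureGroup.toPGL, MonoidHom.comp_apply, ← map_mul]
  exact ProjGenLinGroup.mk_eq_mk_iff.2 ⟨_, rfl⟩

end UCBundle

section Curves

variable {V : Type*} [NormedAddCommGroup V] [NormedSpace ℝ V]
  {H : Type*} [TopologicalSpace H] {I : ModelWithCorners ℝ V H}
  {M : Type*} [TopologicalSpace M] [ChartedSpace H M]

theorem HasMFDerivAt.hasDerivAt_comp {F : M → ℝ} {γ : ℝ → M} {t : ℝ} {w : TangentSpace I (γ t)}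
    {F' : TangentSpace I (γ t) →L[ℝ] ℝ} (hF : HasMFDerivAt I 𝓘(ℝ, ℝ) F (γ t) F')
    (hγ : HasMFDerivAt 𝓘(ℝ, ℝ) I γ t ((1 : ℝ →L[ℝ] ℝ).smulRight w)) :
    HasDerivAt (fun s => F (γ s)) (F' w) t := by
  have h : HasFDerivAt (fun s => F (γ s))
      (F'.comp ((1 : ℝ →L[ℝ] ℝ).smulRight w) : ℝ →L[ℝ] ℝ) t := (hF.comp t hγ).hasFDerivAt
  refine hasDerivAt_iff_hasFDerivAt.2 (h.congr_fderiv (ContinuousLinearMap.ext fun r => ?_))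
  exact F'.map_smul r w

end Curves

namespace UCBundle

lemma hasDerivAt_of_hasMFDerivAt {γ : ℝ → UCBundle} {t : ℝ} {w : ℝ × ℝ × ℝ}
    (hγ : HasMFDerivAt 𝓘(ℝ, ℝ) I3 γ t ((1 : ℝ →L[ℝ] ℝ).smulRight w)) :
    HasDerivAt (fun s => (γ s).1) w.1 t ∧ HasDerivAt (fun s => ((γ s).2.1 : ℝ)) w.2.1 t ∧
      HasDerivAt (fun s => (γ s).2.2) w.2.2 t := by
  refine ⟨?_, ?_, ?_⟩
  · exact HasMFDerivAt.hasDerivAt_comp (F := fun e : UCBundle => e.1)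
      (hasMFDerivAt_fst (M := ℝ) (M' := ℝˣ × ℝ) (γ t)) hγ
  · exact (hasMFDerivAt_a (γ t)).hasDerivAt_comp hγ
  · exact (hasMFDerivAt_b (γ t)).hasDerivAt_comp hγ

lemma contMDiff_lift (i j : Fin 2) : ContMDiff I3 𝓘(ℝ, ℝ) ∞ (fun x : UCBundle => lift x i j) := by
  have hk : ContMDiff I3 𝓘(ℝ, ℝ) ∞
      (fun x : UCBundle => Real.exp (-(Real.log (x.2.1 : ℝ) / 2))) := by
    intro x
    have h : ContDiffAt ℝ ∞ (fun a : ℝ => Real.exp (-(Real.log a / 2))) (x.2.1 : ℝ) :=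
      (((Real.contDiffAt_log.2 x.2.1.ne_zero).div_const 2).neg).exp
    exact ContMDiffAt.comp x (g := fun a : ℝ => Real.exp (-(Real.log a / 2))) h.contMDiffAt
      (contMDiff_a x)
  have hc : ContMDiff I3 𝓘(ℝ, ℝ) ∞ (fun x : UCBundle => Real.cos x.1) :=
    Real.contDiff_cos.contMDiff.comp contMDiff_fst_coord
  have hs : ContMDiff I3 𝓘(ℝ, ℝ) ∞ (fun x : UCBundle => Real.sin x.1) :=
    Real.contDiff_sin.contMDiff.comp contMDiff_fst_coord
  have ha := contMDiff_a
  have hb := contMDiff_b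
  fin_cases i <;> fin_cases j
  · exact (hk.mul (hc.mul ha)).congr fun x => by
      simp [lift, rotMatrix, StructureGroup.toMatrix]
  · exact (hk.mul ((hc.mul hb).sub hs)).congr fun x => by
      simp [lift, rotMatrix, StructureGroup.toMatrix]; ring
  · exact (hk.mul (hs.mul ha)).congr fun x => by
      simp [lift, rotMatrix, StructureGroup.toMatrix]
  · exact (hk.mul ((hs.mul hb).add hc)).congr fun x => by
      simp [lift, rotMatrix, StructureGroup.toMatrix]

/-- Every tangent vector is the velocity of an integral curve of a constant field, so the derivative
is a computation in one variable along that curve. -/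
lemma mfderiv_lift (x : UCBundle) (v : ℝ × ℝ × ℝ) (i j : Fin 2) :
    mfderiv I3 𝓘(ℝ, ℝ) (fun x : UCBundle => lift x i j) x v =
      (lift x * (form x v : Matrix (Fin 2) (Fin 2) ℝ)) i j := by
  obtain ⟨γ, h0, hγ⟩ := ProjectiveConnection.ucModel_isComplete (form x v) x
  have hv : ucModel.vectorField (form x v) (γ 0) = v := by
    rw [h0]
    exact (form x).symm_apply_apply v
  have hγ0 := hγ 0
  rw [hv] at hγ0
  obtain ⟨h1, h2, h3⟩ := hasDerivAt_of_hasMFDerivAt hγ0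
  have h := (((contMDiff_lift i j).mdifferentiableAt (x := γ 0)
    (by simp)).hasMFDerivAt).hasDerivAt_comp hγ0
  rw [h0] at h
  refine h.unique ?_
  have ha := x.2.1.ne_zero
  have hk := ((h2.log (by rw [h0]; exact ha)).div_const 2).neg.exp
  rw [h0] at hk
  have hc := h1.cos
  have hs := h1.sin
  rw [h0] at hc hs
  fin_cases i <;> fin_cases j
  · refine ((hk.mul (hc.mul h2)).congr_of_eventuallyEq (.of_forall fun s => ?_)).congr_deriv ?_
    · simp [lift, rotMatrix, StructureGroup.toMatrix]
    · simp [lift, rotMatrix, StructureGroup.toMatrix, Matrix.mul_apply, Fin.sum_univ_two, form, h0]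
      field_simp
      ring
  · refine ((hk.mul ((hc.mul h3).sub hs)).congr_of_eventuallyEq
      (.of_forall fun s => ?_)).congr_deriv ?_
    · simp [lift, rotMatrix, StructureGroup.toMatrix]
      ring
    · simp [lift, rotMatrix, StructureGroup.toMatrix, Matrix.mul_apply, Fin.sum_univ_two, form, h0]
      field_simp
      ring
  · refine ((hk.mul (hs.mul h2)).congr_of_eventuallyEq (.of_forall fun s => ?_)).congr_deriv ?_
    · simp [lift, rotMatrix, StructureGroup.toMatrix]
    · simp [lift, rotMatrix, StructureGroup.toMatrix, Matrix.mul_apply, Fin.sum_univ_two, form, h0]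
      field_simp
      ring
  · refine ((hk.mul ((hs.mul h3).add hc)).congr_of_eventuallyEq
      (.of_forall fun s => ?_)).congr_deriv ?_
    · simp [lift, rotMatrix, StructureGroup.toMatrix]
    · simp [lift, rotMatrix, StructureGroup.toMatrix, Matrix.mul_apply, Fin.sum_univ_two, form, h0]
      field_simp
      ring

end UCBundle

namespace ProjectiveConnection

/-- The developing map of the model. -/
def stdDevelopingMap : ucModel.DevelopingMap where
  dev := ucProj
  frame := stdFrame
  dev_proj e := by
    rw [stdFrame, mul_smul, basePoint_smul_toPGL, mk_rotGL_smul_basePoint]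
    rfl
  frame_act e g := by
    change stdFrame (e.1, e.2 * g) = _
    rw [stdFrame, stdFrame, map_mul, mul_assoc]
  maurerCartan e₀ := by
    refine ⟨Set.univ, isOpen_univ, trivial, UCBundle.liftGL, fun i j => ?_, fun e _ =>
      ⟨UCBundle.stdFrame_eq_mk e, fun v i j => ?_⟩⟩
    · simp only [UCBundle.coe_liftGL]
      exact (UCBundle.contMDiff_lift i j).contMDiffOn
    · have h : (fun x => (UCBundle.liftGL x : Matrix (Fin 2) (Fin 2) ℝ) i j) =
          fun x => UCBundle.lift x i j := funext fun x => by rw [UCBundle.coe_liftGL]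
      rw [UCBundle.coe_liftGL]
      exact (congrArg (fun F => mfderiv I3 𝓘(ℝ, ℝ) F e v) h).trans
        (UCBundle.mfderiv_lift e v i j)

section
variable {E : Type*} [TopologicalSpace E] [ChartedSpace Model3 E] [IsManifold I3 ∞ E]
  {C : Type*} [TopologicalSpace C] [ChartedSpace ℝ C]
  {P : ProjectiveConnection E C}

/-- Along an integral curve of `A`, a local lift `g` of a developing frame satisfies `g' = g A`. -/
theorem DevelopingMap.exists_lift (D : P.DevelopingMap) (e₀ : E) :
    ∃ V : Set E, IsOpen V ∧ e₀ ∈ V ∧ ∃ g : E → GL (Fin 2) ℝ,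
      (∀ i j, ContMDiffOn I3 𝓘(ℝ, ℝ) ∞ (fun x => (g x : Matrix (Fin 2) (Fin 2) ℝ) i j) V) ∧
      (∀ e ∈ V, D.frame e = ProjGenLinGroup.mk (g e)) ∧
      ∀ (A : sl (Fin 2) ℝ) (γ : ℝ → E) (t : ℝ), γ t ∈ V →
        HasMFDerivAt 𝓘(ℝ, ℝ) I3 γ t ((1 : ℝ →L[ℝ] ℝ).smulRight (P.vectorField A (γ t))) →
        ∀ i j, HasDerivAt (fun s => (g (γ s) : Matrix (Fin 2) (Fin 2) ℝ) i j)
          (((g (γ t) : Matrix (Fin 2) (Fin 2) ℝ) * (A : Matrix (Fin 2) (Fin 2) ℝ)) i j) t := by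
  obtain ⟨V, hV, he₀, g, hg, hg'⟩ := D.maurerCartan e₀
  refine ⟨V, hV, he₀, g, hg, fun e he => (hg' e he).1, fun A γ t ht hγ i j => ?_⟩
  have h1 := (((hg i j).contMDiffAt (hV.mem_nhds ht)).mdifferentiableAt (by simp)).hasMFDerivAt
  refine (h1.hasDerivAt_comp hγ).congr_deriv ?_
  have : P.Ω (γ t) (P.vectorField A (γ t)) = A := (P.Ω (γ t)).apply_symm_apply A
  exact ((hg' _ ht).2 _ i j).trans (by rw [this])

/-- Along an integral curve of the rotation field, a developing frame rotates. -/
theorem DevelopingMap.frame_eventuallyEq (D : P.DevelopingMap) {γ : ℝ → E} {s₀ : ℝ}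
    (hγ : IsMIntegralCurveAt (I := I3) γ (P.vectorField rotGen) s₀) :
    ∀ᶠ s in nhds s₀, D.frame (γ s) * (ProjGenLinGroup.mk (rotGL s))⁻¹ =
      D.frame (γ s₀) * (ProjGenLinGroup.mk (rotGL s₀))⁻¹ := by
  obtain ⟨V, hV, hs₀, g, hg, hfr, hd⟩ := D.exists_lift (γ s₀)
  obtain ⟨ε, hε, hball⟩ := Metric.mem_nhds_iff.1
    (Filter.inter_mem (hγ.continuousAt (hV.mem_nhds hs₀)) hγ)
  have hd' := fun s (hs : s ∈ Metric.ball s₀ ε) => hd rotGen _ s (hball hs).1 (hball hs).2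
  -- Along the curve `g' = g * rotGen`, and `rotMatrix (-s)` has derivative `-rotGen * rotMatrix
  -- (-s)`, so the product `N` has derivative zero.
  let N : ℝ → Matrix (Fin 2) (Fin 2) ℝ := fun s =>
    (g (γ s) : Matrix (Fin 2) (Fin 2) ℝ) * rotMatrix (-s)
  have hN (i j : Fin 2) : ∀ s ∈ Metric.ball s₀ ε, HasDerivAt (fun s => N s i j) 0 s := by
    intro s hs
    have h0 := hd' s hs i 0
    have h1 := hd' s hs i 1
    fin_cases j
    · refine (((h0.mul (Real.hasDerivAt_cos s)).sub
        (h1.mul (Real.hasDerivAt_sin s))).congr_of_eventuallyEq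
        (.of_forall fun s => ?_)).congr_deriv ?_
      · simp [N, rotMatrix, Matrix.mul_apply, Fin.sum_univ_two]; ring
      · simp [rotGen, Matrix.mul_apply, Fin.sum_univ_two]; ring
    · refine (((h0.mul (Real.hasDerivAt_sin s)).add
        (h1.mul (Real.hasDerivAt_cos s))).congr_of_eventuallyEq
        (.of_forall fun s => ?_)).congr_deriv ?_
      · simp [N, rotMatrix, Matrix.mul_apply, Fin.sum_univ_two]
      · simp [rotGen, Matrix.mul_apply, Fin.sum_univ_two]
  have hconst : ∀ s ∈ Metric.ball s₀ ε, N s = N s₀ := by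
    intro s hs
    ext i j
    exact (convex_ball s₀ ε).is_const_of_fderivWithin_eq_zero (𝕜 := ℝ)
      (f := fun s => N s i j)
      (fun s hs => (hN i j s hs).differentiableAt.differentiableWithinAt)
      (fun s hs => by
        rw [fderivWithin_of_isOpen Metric.isOpen_ball hs]
        ext
        simp [(hN i j s hs).deriv]) hs (Metric.mem_ball_self hε)
  filter_upwards [Metric.ball_mem_nhds s₀ hε] with s hs
  rw [hfr _ (hball hs).1, hfr _ hs₀, ← map_inv, ← map_inv, ← map_mul, ← map_mul]
  exact congrArg _ (Units.ext (hconst s hs))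

/-- A developing frame, pulled back to the model along a morphism, is a left translate of the
standard one. -/
theorem DevelopingMap.frame_morphism (D : P.DevelopingMap) {Φ : UCBundle → E} {f : ℝ → C}
    (h : IsMorphism ucModel P Φ f) (s : ℝ) :
    D.frame (Φ (s, 1)) = D.frame (Φ (0, 1)) * ProjGenLinGroup.mk (rotGL s) := by
  have hγ := h.isMIntegralCurve UCBundle.isMIntegralCurve_line
  have hloc : IsLocallyConstant fun s : ℝ =>
      D.frame (Φ (s, 1)) * (ProjGenLinGroup.mk (rotGL s))⁻¹ :=
    (IsLocallyConstant.iff_eventually_eq _).2 fun s₀ =>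
      D.frame_eventuallyEq (hγ.isMIntegralCurveAt s₀)
  have h1 := hloc.apply_eq_of_preconnectedSpace s 0
  simp only [rotGL_zero, map_one, inv_one, mul_one] at h1
  rw [← h1, inv_mul_cancel_right]

/-- Seen from the model, every developing map is `ucProj` followed by a fixed projectivity; this is
why the choice of developing map is immaterial. -/
theorem DevelopingMap.dev_morphism (D : P.DevelopingMap) {Φ : UCBundle → E} {f : ℝ → C}
    (h : IsMorphism ucModel P Φ f) (s : ℝ) :
    D.dev (f s) = D.frame (Φ (0, 1)) • ucProj s := by
  have h1 : P.proj (Φ (s, 1)) = f s := h.proj_eq (s, 1)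
  rw [← h1, D.dev_proj, D.frame_morphism h, mul_smul, mk_rotGL_smul_basePoint]

/-- Every element of `PGL(2, ℝ)` lifts to an automorphism of the model. -/
theorem exists_automorphism_lift (h : PGL(2, ℝ)) :
    ∃ (T : Equiv.Perm UCBundle) (τ : Equiv.Perm ℝ), IsIsomorphism ucModel ucModel T τ ∧
      ∀ s, ucProj (τ s) = h • ucProj s := by
  obtain ⟨x, rfl⟩ := stdFrame_surjective h
  obtain ⟨T, τ, hT, hx⟩ := exists_automorphism (0, 1) x
  refine ⟨T, τ, hT, fun s => ?_⟩
  have h1 := stdDevelopingMap.dev_morphism hT.hom s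
  rw [hx] at h1
  exact h1

end
end ProjectiveConnection

/-! ### Completeness and the universal cover -/

/-- A covering map from the line onto a simply connected space is injective. -/
theorem IsCoveringMap.injective_of_simplyConnectedSpace {X : Type*} [TopologicalSpace X]
    [SimplyConnectedSpace X] [LocallyPathConnectedSpace X] {f : ℝ → X} (hf : IsCoveringMap f) :
    Function.Injective f := by
  intro a b hab
  obtain ⟨s, ⟨hs, hfs⟩, -⟩ := hf.existsUnique_continuousMap_lifts (ContinuousMap.id X) (f a) a rfl
  -- `s` is a section of `f`, so `s ∘ f` and the identity both lift `f`, and they agree at `a`.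
  have h1 : s ∘ f = id := hf.eq_of_comp_eq (s.continuous.comp hf.continuous) continuous_id
    (by rw [← Function.comp_assoc, hfs]; rfl) a hs
  have h2 := congrFun h1 b
  simp only [Function.comp_apply, id] at h2
  rw [← h2, ← hab, hs]

namespace ProjectiveConnection

section
variable {E : Type*} [TopologicalSpace E] [ChartedSpace Model3 E] [IsManifold I3 ∞ E]
  {C : Type*} [TopologicalSpace C] [ChartedSpace ℝ C]
  {P : ProjectiveConnection E C}

theorem exists_isMIntegralCurveAt (P : ProjectiveConnection E C) (A : sl (Fin 2) ℝ) (e : E)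
    (t : ℝ) : ∃ γ : ℝ → E, γ t = e ∧ IsMIntegralCurveAt (I := I3) γ (P.vectorField A) t := by
  have : IsManifold I3 1 E := IsManifold.of_le (n := ∞) (by simp)
  exact exists_isMIntegralCurveAt_of_contMDiffAt_boundaryless t
    (((P.contMDiff_vectorField A).of_le (by simp)) e)

theorem DevelopingMap.frame_proj_ext (D : P.DevelopingMap) {e e' : E} (hp : P.proj e = P.proj e')
    (hf : D.frame e = D.frame e') : e = e' := by
  obtain ⟨g, rfl⟩ := P.exists_act_eq hp
  rw [D.frame_act, left_eq_mul] at hf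
  rw [StructureGroup.toPGL_injective (hf.trans (map_one _).symm), P.act_one]

/-- A connection is complete if its curve is identified by a developing map. -/
theorem DevelopingMap.IdentifiesWithUniversalCover.isComplete {D : P.DevelopingMap}
    (h : D.IdentifiesWithUniversalCover) : P.IsComplete := by
  obtain ⟨δ, hδ⟩ := h
  -- Over each point of the curve the frame singles out one point of the fibre; in the model the
  -- points with frame `rot s` over `s` form the line `(s, 1)`.
  have hex (s : ℝ) : ∃ e : E, P.proj e = δ.symm s ∧ D.frame e = ProjGenLinGroup.mk (rotGL s) := by
    obtain ⟨e, he⟩ := P.proj_surjective (δ.symm s)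
    have h1 : D.frame e • basePoint = ucProj s := by
      rw [← D.dev_proj, he, hδ, δ.apply_symm_apply]
    obtain ⟨g, hg⟩ := exists_stdFrame_eq h1
    refine ⟨P.act e g⁻¹, (P.proj_act _ _).trans he, ?_⟩
    rw [D.frame_act, ← hg, stdFrame, map_inv, mul_inv_cancel_right]
  choose γ hγp hγf using hex
  -- The points `γ s` are merely chosen, so near each `s₀` they are compared with an actual integral
  -- curve `η` through `γ s₀`.
  have hγ : IsMIntegralCurve (I := I3) γ (P.vectorField rotGen) := by
    rw [isMIntegralCurve_iff_isMIntegralCurveAt]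
    intro s₀
    obtain ⟨η, h0, hη⟩ := P.exists_isMIntegralCurveAt rotGen (γ s₀) s₀
    have hf : ∀ᶠ s in nhds s₀, D.frame (η s) = ProjGenLinGroup.mk (rotGL s) := by
      filter_upwards [D.frame_eventuallyEq hη] with s hs
      rw [h0, hγf, mul_inv_cancel] at hs
      exact mul_inv_eq_one.1 hs
    have hc : ContinuousAt (fun s => δ (P.proj (η s)) - s) s₀ :=
      (δ.continuous.continuousAt.comp (P.contMDiff_proj.continuous.continuousAt.comp
        hη.continuousAt)).sub continuousAt_id
    have hc0 : δ (P.proj (η s₀)) - s₀ = 0 := by rw [h0, hγp, δ.apply_symm_apply, sub_self]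
    -- The frame fixes the position on `ℝ` only up to multiples of `π`; continuity rules out the
    -- nonzero ones.
    have hev : ∀ᶠ s in nhds s₀, |δ (P.proj (η s)) - s| < Real.pi := by
      have := hc.abs
      refine this.eventually_lt continuousAt_const ?_
      rw [hc0, abs_zero]
      exact Real.pi_pos
    have heq : ∀ᶠ s in nhds s₀, η s = γ s := by
      filter_upwards [hf, hev] with s hs hs'
      have h1 : ucProj (δ (P.proj (η s))) = ucProj s := by
        rw [← hδ, D.dev_proj, hs, mk_rotGL_smul_basePoint]
      obtain ⟨k, hk⟩ := (ucProj_eq_iff _ _).1 h1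
      rw [hk, add_sub_cancel_left, abs_mul, abs_of_pos Real.pi_pos,
        mul_lt_iff_lt_one_left Real.pi_pos] at hs'
      have hk0 : k = 0 := Int.abs_lt_one_iff.1 (by exact_mod_cast hs')
      refine D.frame_proj_ext ?_ (hs.trans (hγf s).symm)
      rw [hγp, ← δ.symm_apply_apply (P.proj (η s)), hk, hk0]
      simp
    filter_upwards [hη, heq.eventually_nhds] with s hs hs'
    have := hs.congr_of_eventuallyEq (Filter.EventuallyEq.symm hs')
    rwa [hs'.self_of_nhds] at this
  refine (isMorphism_of_isMIntegralCurve hγ).isComplete (fun e => ?_) ucModel_isComplete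
  obtain ⟨g, hg⟩ := P.exists_act_eq (e := γ (δ (P.proj e))) (e' := e)
    (by rw [hγp, δ.symm_apply_apply])
  exact ⟨(δ (P.proj e), g), hg⟩

theorem IsMorphism.fibre_ext {E' : Type*} [TopologicalSpace E'] [ChartedSpace Model3 E']
    [IsManifold I3 ∞ E'] {C' : Type*} [TopologicalSpace C'] [ChartedSpace ℝ C']
    {P' : ProjectiveConnection E' C'} {Φ : E → E'} {f : C → C'} (h : IsMorphism P P' Φ f)
    {e e' : E} (hp : P.proj e = P.proj e') (hΦ : Φ e = Φ e') : e = e' := by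
  obtain ⟨g, rfl⟩ := P.exists_act_eq hp
  rw [h.map_act] at hΦ
  rw [P'.act_injective _ (hΦ.symm.trans (P'.act_one _).symm), P.act_one]

theorem IsMorphism.isMIntegralCurveAt {E' : Type*} [TopologicalSpace E'] [ChartedSpace Model3 E']
    [IsManifold I3 ∞ E'] {C' : Type*} [TopologicalSpace C'] [ChartedSpace ℝ C']
    {P' : ProjectiveConnection E' C'} {Φ : E → E'} {f : C → C'} (h : IsMorphism P P' Φ f)
    {A : sl (Fin 2) ℝ} {γ : ℝ → E} {t : ℝ}
    (hγ : IsMIntegralCurveAt (I := I3) γ (P.vectorField A) t) :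
    IsMIntegralCurveAt (I := I3) (Φ ∘ γ) (P'.vectorField A) t := by
  filter_upwards [hγ] with s hs
  refine (HasMFDerivAt.comp s (h.hasMFDerivAt (γ s)) hs).congr_mfderiv
    (ContinuousLinearMap.ext fun (r : ℝ) => ?_)
  refine Eq.trans ?_ (congrArg (fun w : ℝ × ℝ × ℝ => r • w) (h.map_vectorField A (γ s)))
  exact (mfderiv I3 I3 Φ (γ s)).map_smul r (P.vectorField A (γ s))

/-- A morphism over a covering map reflects completeness of the rotation field. -/
theorem IsMorphism.isRotComplete_of_isCoveringMap {E' : Type*} [TopologicalSpace E']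
    [ChartedSpace Model3 E'] [IsManifold I3 ∞ E'] {C' : Type*} [TopologicalSpace C']
    [ChartedSpace ℝ C'] {P' : ProjectiveConnection E' C'} {Φ : E → E'} {f : C → C'}
    (h : IsMorphism P P' Φ f) (hf : IsCoveringMap f) (hc : P'.IsRotComplete) :
    P.IsRotComplete := by
  intro e
  obtain ⟨γ, h0, hγ⟩ := hc (Φ e)
  -- Only the base curve has to be lifted through the covering. The point of `E` over `F t` is then
  -- determined by its image `γ t`.
  obtain ⟨F, ⟨hF0, hF⟩, -⟩ := hf.existsUnique_continuousMap_lifts (A := ℝ)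
    ⟨P'.proj ∘ γ, P'.contMDiff_proj.continuous.comp hγ.continuous⟩ 0 (P.proj e)
    (by simp [h0, h.proj_eq])
  have hF' (t : ℝ) : f (F t) = P'.proj (γ t) := congrFun hF t
  have hex (t : ℝ) : ∃ x : E, P.proj x = F t ∧ Φ x = γ t := by
    obtain ⟨x, hx⟩ := P.proj_surjective (F t)
    obtain ⟨g, hg⟩ := P'.exists_act_eq (e := Φ x) (e' := γ t) (by rw [h.proj_eq, hx, hF'])
    exact ⟨P.act x g, (P.proj_act _ _).trans hx, (h.map_act x g).trans hg⟩
  choose v hvp hvΦ using hex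
  refine ⟨v, h.fibre_ext ((hvp 0).trans hF0) ((hvΦ 0).trans h0), ?_⟩
  rw [isMIntegralCurve_iff_isMIntegralCurveAt]
  intro t
  obtain ⟨w, hw0, hw⟩ := P.exists_isMIntegralCurveAt rotGen (v t) t
  have : IsManifold I3 1 E' := IsManifold.of_le (n := ∞) (by simp)
  have h1 : γ =ᶠ[nhds t] Φ ∘ w := isMIntegralCurveAt_eventuallyEq_of_contMDiffAt_boundaryless
    (((P'.contMDiff_vectorField rotGen).of_le (by simp)) _) (hγ.isMIntegralCurveAt t)
    (h.isMIntegralCurveAt hw) (by simp [hw0, hvΦ])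
  -- The projected local curve and `F` have the same image under `f` and start at the same point, so
  -- local injectivity of `f` identifies them near `t`.
  obtain ⟨U, hUo, hFU, hinj⟩ := hf.isLocalHomeomorph.isLocallyInjective (F t)
  have h2 : ∀ᶠ s in nhds t, F s ∈ U :=
    F.continuous.continuousAt (hUo.mem_nhds hFU)
  have h3 : ∀ᶠ s in nhds t, P.proj (w s) ∈ U :=
    (P.contMDiff_proj.continuous.continuousAt.comp hw.continuousAt)
      (hUo.mem_nhds (by rwa [Function.comp_apply, hw0, hvp]))
  have heq : ∀ᶠ s in nhds t, w s = v s := by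
    filter_upwards [h1, h2, h3] with s hs1 hs2 hs3
    have h4 : Φ (w s) = γ s := hs1.symm
    refine h.fibre_ext ((hinj hs3 hs2 ?_).trans (hvp s).symm) (h4.trans (hvΦ s).symm)
    rw [← h.proj_eq, h4, hF']
  filter_upwards [hw, heq.eventually_nhds] with s hs hs'
  have := hs.congr_of_eventuallyEq (Filter.EventuallyEq.symm hs')
  rwa [hs'.self_of_nhds] at this

/-- The range is closed as well as open: over an evenly covered neighbourhood of `y`, a point above
any element yields a point above `y`. -/
theorem _root_.IsCoveringMap.surjective_of_preconnectedSpace {X Y : Type*} [TopologicalSpace X]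
    [TopologicalSpace Y] [Nonempty X] [PreconnectedSpace Y] {f : X → Y} (hf : IsCoveringMap f) :
    Function.Surjective f := by
  have hcl : IsClosed (Set.range f) := by
    rw [← isOpen_compl_iff, isOpen_iff_mem_nhds]
    intro y hy
    obtain ⟨-, U, hyU, hU, -, H, -⟩ := hf y
    filter_upwards [hU.mem_nhds hyU]
    rintro _ hx ⟨x, rfl⟩
    exact hy ⟨_, (H ⟨x, hx⟩).2.2⟩
  exact Set.range_eq_univ.1 (IsClopen.eq_univ ⟨hcl, hf.isOpenMap.isOpen_range⟩
    (Set.range_nonempty f))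

theorem UniversalCover.surjective_bundleMap [PreconnectedSpace C] (U : UniversalCover P) :
    Function.Surjective U.bundleMap :=
  U.isMorphism.surjective_of_base U.isCoveringMap.surjective_of_preconnectedSpace

/-- The base map of a morphism from the model is a covering of a simply connected curve by `ℝ`,
hence bijective, and a bijective morphism is an isomorphism. -/
theorem UniversalCover.exists_isIsomorphism (U : UniversalCover P) (h : P.IsComplete) :
    ∃ (Φ : UCBundle ≃ U.Bundle) (f : ℝ ≃ U.Curve), IsIsomorphism ucModel U.conn Φ f := by
  have hr := U.isMorphism.isRotComplete_of_isCoveringMap U.isCoveringMap h.isRotComplete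
  obtain ⟨e⟩ : Nonempty U.Bundle :=
    ⟨(U.conn.proj_surjective (Classical.arbitrary U.Curve)).choose⟩
  obtain ⟨Φ, f, hΦ, -⟩ := hr.exists_isMorphism (0, 1) e
  have : LocallyPathConnectedSpace U.Curve := ChartedSpace.locallyPathConnectedSpace ℝ U.Curve
  have hs := hΦ.surjective hr
  have hi := (hΦ.isCoveringMap hs).injective_of_simplyConnectedSpace
  obtain ⟨Ψ, k, -, -, hk⟩ := hΦ.exists_isIsomorphism ⟨hΦ.injective_of_base hi, hs⟩
  exact ⟨Ψ, k, hk⟩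

/-- By `dev_morphism`, `D.dev ∘ f` is `ucProj` followed by a projectivity. With `τ` a lift of the
latter to `ℝ`, the diffeomorphism is `τ ∘ f⁻¹`. -/
theorem identifiesWithUniversalCover_of_isIsomorphism (D : P.DevelopingMap) {Φ : UCBundle ≃ E}
    {f : ℝ ≃ C} (h : IsIsomorphism ucModel P Φ f) : D.IdentifiesWithUniversalCover := by
  obtain ⟨T, τ, hT, hτ⟩ := exists_automorphism_lift (D.frame (Φ (0, 1)))
  refine ⟨⟨f.symm.trans τ, hT.hom.contMDiff_base.comp h.inv.contMDiff_base,
    h.hom.contMDiff_base.comp hT.inv.contMDiff_base⟩, fun c => ?_⟩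
  have h1 := D.dev_morphism h.hom (f.symm c)
  rw [f.apply_symm_apply] at h1
  exact h1.trans (hτ _).symm

theorem UniversalCover.isComplete_iff [PreconnectedSpace C] (U : UniversalCover P)
    (D : U.conn.DevelopingMap) : P.IsComplete ↔ D.IdentifiesWithUniversalCover := by
  constructor
  · intro h
    obtain ⟨Φ, f, hΦ⟩ := U.exists_isIsomorphism h
    exact identifiesWithUniversalCover_of_isIsomorphism D hΦ
  · intro h
    exact U.isMorphism.isComplete U.surjective_bundleMap h.isComplete

instance : SecondCountableTopology StructureGroup := by
  have h1 : SecondCountableTopology ℝˣ :=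
    Units.isOpenEmbedding_val.isInducing.secondCountableTopology
  exact inferInstanceAs (SecondCountableTopology (ℝˣ × ℝ))

/-- The universal cover of the curve of a complete connection. -/
theorem IsComplete.exists_universalCover [T2Space E] [PreconnectedSpace C] [Nonempty C]
    (h : P.IsComplete) : ∃ U : UniversalCover.{0, 0} P, Nonempty (U.conn.DevelopingMap) := by
  obtain ⟨e, -⟩ := P.proj_surjective (Classical.arbitrary C)
  obtain ⟨Φ, f, hΦ, -⟩ := h.isRotComplete.exists_isMorphism (0, 1) e
  -- The model itself serves as the universal cover, since `f` is a covering map and `ℝ` is simply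
  -- connected.
  exact ⟨{
    Curve := ℝ
    Bundle := UCBundle
    conn := ucModel
    cover := f
    bundleMap := Φ
    isCoveringMap := hΦ.isCoveringMap (hΦ.surjective h.isRotComplete)
    isMorphism := hΦ }, ⟨stdDevelopingMap⟩⟩

end
end ProjectiveConnection

/-! ### Lifts of projectivities to the line, and conjugacy classes in PGL(2, ℝ) -/

namespace StructureGroup

lemma affine_mul (a c : ℝˣ) (b d : ℝ) : affine a b * affine c d = affine (a * c) (a * d + b) := rfl

lemma affine_inv (a : ℝˣ) (b : ℝ) : (affine a b)⁻¹ = affine a⁻¹ (-((a⁻¹ : ℝˣ) * b)) := rfl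

lemma affine_one : affine 1 0 = 1 := rfl

lemma coe_toGL_affine (a : ℝˣ) (b : ℝ) :
    (toGL (affine a b) : Matrix (Fin 2) (Fin 2) ℝ) = !![(a : ℝ), b; 0, 1] := rfl

end StructureGroup

theorem exists_int_mul_pi_of_continuous {u : ℝ → ℝ} (hu : Continuous u)
    (h : ∀ x, ∃ k : ℤ, u x = k * Real.pi) : ∃ k : ℤ, ∀ x, u x = k * Real.pi := by
  choose k hk using h
  have hpi := Real.pi_pos
  have hloc : IsLocallyConstant k := by
    rw [IsLocallyConstant.iff_eventually_eq]
    intro x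
    have h1 : ∀ᶠ y in nhds x, |u y - u x| < Real.pi := by
      refine ((hu.sub continuous_const).abs.continuousAt).eventually_lt continuousAt_const ?_
      simpa using hpi
    filter_upwards [h1] with y hy
    rw [hk, hk, ← sub_mul, abs_mul, abs_of_pos hpi, mul_lt_iff_lt_one_left hpi] at hy
    exact sub_eq_zero.1 (Int.abs_lt_one_iff.1 (by exact_mod_cast hy))
  exact ⟨k 0, fun x => by rw [hk, hloc.apply_eq_of_preconnectedSpace x 0]⟩

lemma mk_rotGL_smul_ucProj (θ φ : ℝ) :
    ProjGenLinGroup.mk (rotGL θ) • ucProj φ = ucProj (φ + θ) := by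
  rw [← mk_rotGL_smul_basePoint, ← mk_rotGL_smul_basePoint, ← mul_smul, ← map_mul]
  congr 2
  refine Units.ext ?_
  rw [Units.val_mul, coe_rotGL, coe_rotGL, coe_rotGL, ← rotMatrix_add, add_comm]

lemma ucProj_zero : ucProj 0 = basePoint := by
  rw [← mk_rotGL_smul_basePoint, rotGL_zero, map_one, one_smul]

/-- An increasing lift of an affine map is the standard one followed by a translation. -/
theorem exists_isAffineLift {g : StructureGroup} {τ : ℝ → ℝ} (hc : Continuous τ)
    (hm : StrictMono τ) (h : ∀ φ, ucProj (τ φ) = g.toPGL • ucProj φ) :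
    ∃ n : ℤ, ProjectiveConnection.IsAffineLift g (fun φ => τ φ - n * Real.pi) := by
  have hpi := Real.pi_pos
  have hper : ∀ φ, τ (φ + Real.pi) = τ φ + Real.pi := by
    obtain ⟨k, hk⟩ := exists_int_mul_pi_of_continuous
      (u := fun φ => τ (φ + Real.pi) - τ φ) (by fun_prop) (fun φ => by
        obtain ⟨k, hk⟩ := (ucProj_eq_iff (τ (φ + Real.pi)) (τ φ)).1 (by
          rw [h, h]
          congr 1
          exact (ucProj_eq_iff _ _).2 ⟨1, by simp⟩)
        exact ⟨k, by rw [hk]; ring⟩)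
    have hk0 : (0 : ℝ) < k := by
      have := hk 0
      have h1 := hm (show (0 : ℝ) < 0 + Real.pi by linarith)
      exact pos_of_mul_pos_left (by linarith) hpi.le
    -- If `k ≥ 2`, then `τ` takes the value `τ 0 + π` inside `(0, π)`, so the projectivity takes the
    -- same value at two distinct points.
    have hk1 : k = 1 := by
      by_contra hne
      have h2 : (2 : ℝ) ≤ k := by
        have : (0 : ℤ) < k := by exact_mod_cast hk0
        exact_mod_cast (by omega : (2 : ℤ) ≤ k)
      have h3 : τ (0 + Real.pi) = τ 0 + k * Real.pi := by linarith [hk 0]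
      obtain ⟨ψ, ⟨hψ0, hψ1⟩, hψ⟩ := intermediate_value_Ioo (a := 0) (b := 0 + Real.pi)
        (by linarith) hc.continuousOn
        (show τ 0 + Real.pi ∈ Set.Ioo (τ 0) (τ (0 + Real.pi)) by
          rw [h3]; constructor <;> nlinarith)
      have h4 : g.toPGL • ucProj ψ = g.toPGL • ucProj 0 := by
        rw [← h, ← h, hψ]
        exact (ucProj_eq_iff _ _).2 ⟨1, by simp⟩
      obtain ⟨j, hj⟩ := (ucProj_eq_iff _ _).1 (MulAction.injective _ h4)
      rw [zero_add] at hj hψ1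
      have hj0 : (0 : ℝ) < j := pos_of_mul_pos_left (by linarith) hpi.le
      have hj1 : (j : ℝ) < 1 := by
        by_contra! hge
        nlinarith
      have h5 : (0 : ℤ) < j := by exact_mod_cast hj0
      have h6 : j < (1 : ℤ) := by exact_mod_cast hj1
      omega
    intro φ
    have := hk φ
    simp only [hk1, Int.cast_one, one_mul] at this
    linarith
  obtain ⟨n, hn⟩ := (ucProj_eq_iff (τ 0) 0).1 (by rw [h, ucProj_zero, basePoint_smul_toPGL])
  refine ⟨n, by fun_prop, fun k => ?_, fun φ => ?_⟩
  · have key : ∀ k : ℤ, τ (k * Real.pi) = τ 0 + k * Real.pi := by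
      intro k
      induction k using Int.induction_on with
      | zero => simp
      | succ i ih =>
        have := hper ((i : ℤ) * Real.pi)
        rw [ih] at this
        push_cast at this ⊢
        rw [add_mul, one_mul, this]
        ring
      | pred i ih =>
        have := hper ((-(i : ℤ) - 1 : ℤ) * Real.pi)
        have h1 : ((-(i : ℤ) - 1 : ℤ) : ℝ) * Real.pi + Real.pi = (-(i : ℤ) : ℤ) * Real.pi := by
          push_cast; ring
        rw [h1, ih] at this
        push_cast at this ⊢
        linarith
    simp only [key, hn]
    ring
  · rw [← h]
    exact (ucProj_eq_iff _ _).2 ⟨-n, by push_cast; ring⟩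

/-- Maps with negative multiplier reverse the orientation. -/
theorem not_isAffineLift_of_neg {r : ℝˣ} (hr : (r : ℝ) < 0) {σ : ℝ → ℝ} (hm : StrictMono σ) :
    ¬ ProjectiveConnection.IsAffineLift (StructureGroup.affine r 0) σ := by
  intro h
  have hpi := Real.pi_pos
  have h0 : σ 0 = 0 := by simpa using h.map_infty 0
  have h1 : σ Real.pi = Real.pi := by simpa using h.map_infty 1
  have hact (φ : ℝ) : ∃ a : ℝ, a * (r * Real.cos φ) = Real.cos (σ φ) ∧
      a * Real.sin φ = Real.sin (σ φ) := by
    have h2 := h.lifts φ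
    rw [ucProj, ucProj, StructureGroup.toPGL, MonoidHom.comp_apply,
      Projectivization.PGL.mk_smul_mk, Projectivization.mk_eq_mk_iff'] at h2
    obtain ⟨a, ha⟩ := h2
    refine ⟨a, ?_, ?_⟩
    · simpa [-StructureGroup.coe_toGL, StructureGroup.coe_toGL_affine] using congrFun ha 0
    · simpa [-StructureGroup.coe_toGL, StructureGroup.coe_toGL_affine] using congrFun ha 1
  -- `φ = π / 2` is the point `x = 0`, fixed by `x ↦ r x`; monotonicity keeps its image strictly
  -- between `0` and `π`.
  have h2 : σ (Real.pi / 2) = Real.pi / 2 := by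
    obtain ⟨a, ha, -⟩ := hact (Real.pi / 2)
    rw [Real.cos_pi_div_two, mul_zero, mul_zero] at ha
    have h3 : 0 < σ (Real.pi / 2) := by rw [← h0]; exact hm (by linarith)
    have h4 : σ (Real.pi / 2) < Real.pi := by
      conv_rhs => rw [← h1]
      exact hm (by linarith)
    exact Real.injOn_cos ⟨h3.le, h4.le⟩ ⟨by linarith, by linarith⟩
      (by rw [← ha, Real.cos_pi_div_two])
  -- At `φ = π / 4`, where `x = 1`, the image stays in `(0, π / 2)`, where `x > 0`, although its
  -- coordinate is `r < 0`.
  obtain ⟨a, ha, ha'⟩ := hact (Real.pi / 4)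
  have h3 : 0 < σ (Real.pi / 4) := by rw [← h0]; exact hm (by linarith)
  have h4 : σ (Real.pi / 4) < Real.pi / 2 := by
    conv_rhs => rw [← h2]
    exact hm (by linarith)
  have h5 := Real.cos_pos_of_mem_Ioo ⟨by linarith, h4⟩
  have h6 := Real.sin_pos_of_pos_of_lt_pi h3 (by linarith)
  have h7 : 0 < Real.cos (Real.pi / 4) := Real.cos_pos_of_mem_Ioo ⟨by linarith, by linarith⟩
  have h8 : 0 < Real.sin (Real.pi / 4) := Real.sin_pos_of_pos_of_lt_pi (by linarith) (by linarith)
  rw [← ha'] at h6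
  have h9 : 0 < a := pos_of_mul_pos_left h6 h8.le
  rw [← ha] at h5
  have := mul_pos h9 h7
  nlinarith

/-- Rotations lift to translations. -/
theorem exists_eq_add_of_rot {θ : ℝ} {τ : ℝ → ℝ} (hc : Continuous τ)
    (h : ∀ φ, ucProj (τ φ) = ProjGenLinGroup.mk (rotGL θ) • ucProj φ) :
    ∃ θ' : ℝ, ∀ φ, τ φ = φ + θ' := by
  obtain ⟨k, hk⟩ := exists_int_mul_pi_of_continuous (u := fun φ => τ φ - (φ + θ)) (by fun_prop)
    (fun φ => by
      obtain ⟨k, hk⟩ := (ucProj_eq_iff (τ φ) (φ + θ)).1 (by rw [h, mk_rotGL_smul_ucProj])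
      exact ⟨k, by rw [hk]; ring⟩)
  exact ⟨θ + k * Real.pi, fun φ => by linarith [hk φ]⟩

/-- An element of `PGL(2, ℝ)` that fixes a point is conjugate to an affine map. -/
lemma exists_conj_toPGL {h : PGL(2, ℝ)} {p : ℙ ℝ (Fin 2 → ℝ)} (hp : h • p = p) :
    ∃ (s : PGL(2, ℝ)) (g : StructureGroup), s * h * s⁻¹ = g.toPGL := by
  obtain ⟨ψ, rfl⟩ := ucProj_surjective p
  rw [← mk_rotGL_smul_basePoint] at hp
  have : (ProjGenLinGroup.mk (rotGL ψ))⁻¹ * h * ProjGenLinGroup.mk (rotGL ψ) ∈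
      StructureGroup.toPGL.range := by
    rw [StructureGroup.range_toPGL, MulAction.mem_stabilizer_iff, mul_smul, mul_smul, hp,
      inv_smul_smul]
  obtain ⟨g, hg⟩ := this
  exact ⟨(ProjGenLinGroup.mk (rotGL ψ))⁻¹, g, by rw [hg, inv_inv]⟩

/-- An affine map is conjugate to a rotation, to `x ↦ x + 1`, or to `x ↦ r * x`. -/
lemma exists_conj_normalForm_affine (g : StructureGroup) :
    ∃ s : PGL(2, ℝ), (∃ θ, s * g.toPGL * s⁻¹ = ProjGenLinGroup.mk (rotGL θ)) ∨
      s * g.toPGL * s⁻¹ = (StructureGroup.affine 1 1).toPGL ∨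
      ∃ r : ℝˣ, (1 < (r : ℝ) ∨ (r : ℝ) < 0) ∧
        s * g.toPGL * s⁻¹ = (StructureGroup.affine r 0).toPGL := by
  obtain ⟨a, b, rfl⟩ : ∃ a b, g = .affine a b := ⟨g.1, g.2, rfl⟩
  by_cases ha : a = 1
  · subst ha
    by_cases hb : b = 0
    · subst hb
      exact ⟨1, Or.inl ⟨0, by simp [StructureGroup.affine_one]⟩⟩
    · refine ⟨(StructureGroup.affine (Units.mk0 b⁻¹ (inv_ne_zero hb)) 0).toPGL,
        Or.inr (Or.inl ?_)⟩
      rw [← map_inv, ← map_mul, ← map_mul]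
      simp [StructureGroup.affine_mul, StructureGroup.affine_inv, hb]
  · have ha' : (a : ℝ) - 1 ≠ 0 := fun h => ha (Units.ext (by simpa [sub_eq_zero] using h))
    -- The translation that carries the fixed point `b / (1 - a)` to `0`.
    let u : StructureGroup := .affine 1 (b / (a - 1))
    have hu : u.toPGL * (StructureGroup.affine a b).toPGL * u.toPGL⁻¹ =
        (StructureGroup.affine a 0).toPGL := by
      rw [← map_inv, ← map_mul, ← map_mul]
      simp only [u, StructureGroup.affine_mul, StructureGroup.affine_inv]
      congr 2
      · simp
      · simp
        field_simp
        ring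
    by_cases h1 : 1 < (a : ℝ) ∨ (a : ℝ) < 0
    · exact ⟨u.toPGL, Or.inr (Or.inr ⟨a, h1, hu⟩)⟩
    · push Not at h1
      have ha0 : (0 : ℝ) < a := lt_of_le_of_ne h1.2 a.ne_zero.symm
      have ha1 : (a : ℝ) < 1 := lt_of_le_of_ne h1.1 fun h => ha' (by rw [h, sub_self])
      -- The quarter turn is `x ↦ -1 / x`; it exchanges `0` and `∞` and inverts the multiplier, so
      -- `0 < a < 1` reduces to `a > 1`.
      let w := ProjGenLinGroup.mk (rotGL (Real.pi / 2))
      refine ⟨w * u.toPGL, Or.inr (Or.inr ⟨a⁻¹, Or.inl ?_, ?_⟩)⟩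
      · rw [Units.val_inv_eq_inv_val]
        exact (one_lt_inv₀ ha0).2 ha1
      · have : w * u.toPGL * (StructureGroup.affine a b).toPGL * (w * u.toPGL)⁻¹ =
            w * (u.toPGL * (StructureGroup.affine a b).toPGL * u.toPGL⁻¹) * w⁻¹ := by group
        rw [this, hu, mul_inv_eq_iff_eq_mul, StructureGroup.toPGL, MonoidHom.comp_apply,
          MonoidHom.comp_apply, ← map_mul, ← map_mul]
        refine (ProjGenLinGroup.mk_eq_mk_iff.2 ⟨a, Units.ext ?_⟩).symm
        ext i j
        fin_cases i <;> fin_cases j <;>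
          simp [-StructureGroup.coe_toGL, StructureGroup.coe_toGL_affine, rotMatrix,
            Matrix.mul_apply, Fin.sum_univ_two]

/-- Normal forms for the conjugacy classes of `PGL(2, ℝ)`. -/
theorem exists_conj_normalForm (h : PGL(2, ℝ)) :
    ∃ s : PGL(2, ℝ), (∃ θ, s * h * s⁻¹ = ProjGenLinGroup.mk (rotGL θ)) ∨
      s * h * s⁻¹ = (StructureGroup.affine 1 1).toPGL ∨
      ∃ r : ℝˣ, (1 < (r : ℝ) ∨ (r : ℝ) < 0) ∧
        s * h * s⁻¹ = (StructureGroup.affine r 0).toPGL := by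
  by_cases hfix : ∃ p : ℙ ℝ (Fin 2 → ℝ), h • p = p
  · obtain ⟨p, hp⟩ := hfix
    obtain ⟨s, g, hs⟩ := exists_conj_toPGL hp
    obtain ⟨s', hs'⟩ := exists_conj_normalForm_affine g
    have : s' * g.toPGL * s'⁻¹ = (s' * s) * h * (s' * s)⁻¹ := by rw [← hs]; group
    rw [this] at hs'
    exact ⟨_, hs'⟩
  · induction h using ProjGenLinGroup.induction_on with | mk m =>
    set p := m 0 0 with hp
    set q := m 0 1 with hq
    set r := m 1 0 with hr
    set t := m 1 1 with ht
    -- Fixed points are eigenlines, so there is no real eigenvector, and the discriminant below must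
    -- be negative.
    have heig : ∀ (v : Fin 2 → ℝ), v ≠ 0 → ∀ l : ℝ, p * v 0 + q * v 1 = l * v 0 →
        r * v 0 + t * v 1 = l * v 1 → False := by
      intro v hv l h0 h1
      refine hfix ⟨Projectivization.mk ℝ v hv, ?_⟩
      rw [Projectivization.PGL.mk_smul_mk, Projectivization.mk_eq_mk_iff']
      refine ⟨l, ?_⟩
      ext i
      fin_cases i
      · simpa [Matrix.mulVec, dotProduct, Fin.sum_univ_two] using h0.symm
      · simpa [Matrix.mulVec, dotProduct, Fin.sum_univ_two] using h1.symm
    have hr0 : r ≠ 0 := by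
      intro h0
      exact heig ![1, 0] (by simp) p (by simp) (by simp [h0])
    have hdisc : (p - t) ^ 2 + 4 * q * r < 0 := by
      by_contra! hd
      have hs := Real.sq_sqrt hd
      set d := √((p - t) ^ 2 + 4 * q * r)
      refine heig ![(p + t + d) / 2 - t, r] (fun h => hr0 (by simpa using congrFun h 1))
        ((p + t + d) / 2) ?_ ?_
      · simp; nlinarith
      · simp; ring
    obtain ⟨β, hβ0, hβ⟩ : ∃ β : ℝ, 0 < β ∧ 4 * β ^ 2 = -((p - t) ^ 2 + 4 * q * r) :=
      ⟨√(-((p - t) ^ 2 + 4 * q * r)) / 2, by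
        have := Real.sqrt_pos.2 (neg_pos.2 hdisc)
        positivity, by
        rw [div_pow, Real.sq_sqrt (by linarith)]; ring⟩
    set α := (p + t) / 2 with hα
    let z : ℂ := ⟨α, β⟩
    have hz : z ≠ 0 := fun h => hβ0.ne' (congrArg Complex.im h)
    have hn : ‖z‖ ≠ 0 := norm_ne_zero_iff.2 hz
    have hcos : ‖z‖ * Real.cos z.arg = α := by
      rw [Complex.cos_arg hz]
      field_simp
      rfl
    have hsin : ‖z‖ * Real.sin z.arg = β := by
      rw [Complex.sin_arg]
      field_simp
      rfl
    -- With eigenvalues `α ± iβ`, the columns of `Q` are `e₁` and `(m - α) e₁ / β`. Since `(m - α)²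
    -- = -β²`, in this basis `m` is `!![α, -β; β, α]`, which is `‖z‖` times a rotation.
    let Q : GL (Fin 2) ℝ := Matrix.GeneralLinearGroup.mkOfDetNeZero
      !![1, (p - α) / β; 0, r / β] (by simp [Matrix.det_fin_two, hr0, hβ0.ne'])
    have hQ : (Q : Matrix (Fin 2) (Fin 2) ℝ) = !![1, (p - α) / β; 0, r / β] := rfl
    refine ⟨(ProjGenLinGroup.mk Q)⁻¹, Or.inl ⟨z.arg, ?_⟩⟩
    rw [inv_inv, mul_assoc, inv_mul_eq_iff_eq_mul, ← map_mul, ← map_mul]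
    refine (ProjGenLinGroup.mk_eq_mk_iff.2 ⟨Units.mk0 _ hn, Units.ext ?_⟩).symm
    have e : (Q : Matrix (Fin 2) (Fin 2) ℝ) * (‖z‖ • rotMatrix z.arg) =
        (m : Matrix (Fin 2) (Fin 2) ℝ) * Q := by
      have hm : (m : Matrix (Fin 2) (Fin 2) ℝ) = !![p, q; r, t] := by
        ext i j
        fin_cases i <;> fin_cases j <;> rfl
      have hrot : ‖z‖ • rotMatrix z.arg = !![α, -β; β, α] := by
        ext i j
        fin_cases i <;> fin_cases j <;> simp [rotMatrix, hcos, hsin]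
      rw [hm, hrot, hQ]
      ext i j
      fin_cases i <;> fin_cases j <;>
        simp [Matrix.mul_apply, Fin.sum_univ_two] <;> field_simp
      · ring
      · rw [hα]
        linear_combination (-1 / 4) * hβ
      · rw [hα]
        ring
    refine Eq.trans ?_ e
    simp [smul_eq_mul_diagonal, mul_assoc]

/-! ### Normal forms of the quotients of the model -/

namespace ProjectiveConnection

section
variable {E : Type*} [TopologicalSpace E] [ChartedSpace Model3 E] [IsManifold I3 ∞ E]
  {C : Type*} [TopologicalSpace C] [ChartedSpace ℝ C]
  {P : ProjectiveConnection E C}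

theorem IsModelQuotient.isComplete {τ : Equiv.Perm ℝ} (h : P.IsModelQuotient τ) :
    P.IsComplete := by
  obtain ⟨-, -, Φ, f, hΦ, hs, -⟩ := h
  exact hΦ.isComplete hs ucModel_isComplete

/-- Conjugating by an automorphism of the model presents the same quotient. -/
theorem IsModelQuotient.conj {τ : Equiv.Perm ℝ} (h : P.IsModelQuotient τ)
    {S : Equiv.Perm UCBundle} {σ : Equiv.Perm ℝ} (hS : IsIsomorphism ucModel ucModel S σ) :
    P.IsModelQuotient (σ * τ * σ⁻¹) := by
  obtain ⟨T, hT, Φ, f, hΦ, hs, hfib⟩ := h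
  refine ⟨S * T * S⁻¹, hS.symm.trans (hT.trans hS), Φ ∘ S.symm, f ∘ σ.symm, hS.symm.hom.comp hΦ,
    hs.comp S.symm.surjective, fun x y => ?_⟩
  refine (hfib _ _).trans (exists_congr fun k => ?_)
  rw [conj_zpow]
  exact Equiv.eq_symm_apply S

/-- An element of the deck group that generates it presents the quotient. -/
theorem IsMorphism.isModelQuotient {Φ : UCBundle → E} {f : ℝ → C} [T2Space E]
    (h : IsMorphism ucModel P Φ f) (hs : Function.Surjective Φ)
    {p : Equiv.Perm UCBundle × Equiv.Perm ℝ} (hp : p ∈ deckGroup Φ)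
    (hgen : ∀ q ∈ deckGroup Φ, ∃ k : ℤ, p ^ k = q) : P.IsModelQuotient p.2 := by
  refine ⟨p.1, hp.1, Φ, f, h, hs, fun x y => ⟨fun hxy => ?_, ?_⟩⟩
  · obtain ⟨q, hq, hqx⟩ := h.exists_deck hxy.symm
    obtain ⟨k, rfl⟩ := hgen q hq
    exact ⟨k, hqx⟩
  · rintro ⟨k, rfl⟩
    exact ((zpow_mem hp k).2 x).symm

/-- A quotient of the model by an automorphism without fixed points on the base has a normal
form. -/
theorem IsModelQuotient.classification {τ : Equiv.Perm ℝ} (h : P.IsModelQuotient τ)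
    (hτ : ∀ φ, τ φ ≠ φ) :
    P.IsElliptic ∨ P.IsClosedParabolicTwo ∨ P.IsClosedHyperbolicTwo := by
  obtain ⟨T, hT, -⟩ := id h
  -- `stdFrame (T (0, 1))` is the projectivity that `τ` covers.
  obtain ⟨s, hs⟩ := exists_conj_normalForm (stdFrame (T (0, 1)))
  obtain ⟨S, σ, hS, hσ⟩ := exists_automorphism_lift s
  have hτ' (φ : ℝ) : ucProj (τ φ) = stdFrame (T (0, 1)) • ucProj φ :=
    stdDevelopingMap.dev_morphism hT.hom φ
  have hσ' (φ : ℝ) : ucProj (σ⁻¹ φ) = s⁻¹ • ucProj φ := by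
    rw [eq_inv_smul_iff, ← hσ, ← Equiv.Perm.mul_apply, mul_inv_cancel, Equiv.Perm.one_apply]
  have hq := h.conj hS
  set ρ : Equiv.Perm ℝ := σ * τ * σ⁻¹ with hρ
  have hlift (φ : ℝ) : ucProj (ρ φ) = (s * stdFrame (T (0, 1)) * s⁻¹) • ucProj φ := by
    rw [hρ, Equiv.Perm.mul_apply, Equiv.Perm.mul_apply, hσ, hτ', hσ', mul_smul, mul_smul]
  have hne (φ : ℝ) : ρ φ ≠ φ := by
    intro hfix
    refine hτ (σ⁻¹ φ) (σ.injective ?_)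
    rw [← Equiv.Perm.mul_apply σ σ⁻¹, mul_inv_cancel]
    exact hfix
  have hc : Continuous ρ := by
    obtain ⟨_, h1, -⟩ := id hq
    exact h1.hom.contMDiff_base.continuous
  have hm : StrictMono ρ := strictMono_of_forall_ne hc ρ.injective hne
  have haffine {g : StructureGroup} (hg : s * stdFrame (T (0, 1)) * s⁻¹ = g.toPGL) :
      ∃ n : ℤ, n ≠ 0 ∧ IsAffineLift g (fun φ => ρ φ - n * Real.pi) := by
    obtain ⟨n, hn⟩ := exists_isAffineLift hc hm (fun φ => by rw [hlift, hg])
    refine ⟨n, ?_, hn⟩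
    rintro rfl
    -- With `n = 0` the map would fix the point at infinity `φ = 0`.
    exact hne 0 (by simpa using hn.map_infty 0)
  rcases hs with ⟨θ, hθ⟩ | hpar | ⟨r, hr, hhyp⟩
  · obtain ⟨θ', hθ'⟩ := exists_eq_add_of_rot hc (θ := θ) (fun φ => by rw [hlift, hθ])
    have h1 : ρ = Equiv.addRight θ' := Equiv.ext hθ'
    refine Or.inl (Or.inr ⟨θ', ?_, h1 ▸ hq⟩)
    rintro rfl
    exact hne 0 (by simp [hθ'])
  · obtain ⟨n, hn, hl⟩ := haffine hpar
    exact Or.inr (Or.inl ⟨n, hn, _, ρ, hl, fun φ => by ring, hq⟩)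
  · obtain ⟨n, hn, hl⟩ := haffine hhyp
    rcases hr with hr | hr
    · exact Or.inr (Or.inr ⟨r, n, hr, hn, _, ρ, hl, fun φ => by ring, hq⟩)
    · exact (not_isAffineLift_of_neg hr (fun a b hab => sub_lt_sub_right (hm hab) _) hl).elim

/-- A trivial deck group makes `Φ` an isomorphism with the model, the open elliptic case; otherwise
a generator presents `P` as a quotient to be normalized. Conversely, each normal form is an image of
the complete model. -/
theorem isComplete_iff_classification [T2Space E] [T2Space C] [ConnectedSpace C] :
    P.IsComplete ↔ P.IsElliptic ∨ P.IsClosedParabolicTwo ∨ P.IsClosedHyperbolicTwo := by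
  constructor
  · intro h
    obtain ⟨e, -⟩ := P.proj_surjective (Classical.arbitrary C)
    obtain ⟨Φ, f, hΦ, -⟩ := h.isRotComplete.exists_isMorphism (0, 1) e
    have hs := hΦ.surjective h.isRotComplete
    rcases hΦ.deckGroup_cyclic with h1 | ⟨p, hp, hlt, hgen⟩
    · have hi : Function.Injective Φ := by
        intro x y hxy
        obtain ⟨q, hq, hqy⟩ := hΦ.exists_deck hxy
        rw [h1 q hq] at hqy
        exact hqy.symm
      obtain ⟨Ψ, k, -, -, hk⟩ := hΦ.exists_isIsomorphism ⟨hi, hs⟩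
      exact Or.inl (Or.inl ⟨Ψ, k, hk⟩)
    · exact (hΦ.isModelQuotient hs hp hgen).classification fun φ => (hlt φ).ne'
  · rintro ((⟨Φ, f, h⟩ | ⟨_, -, h⟩) | ⟨_, -, _, _, -, -, h⟩ | ⟨_, _, -, -, _, _, -, -, h⟩)
    · exact h.hom.isComplete Φ.surjective ucModel_isComplete
    · exact h.isComplete
    · exact h.isComplete
    · exact h.isComplete

end
end ProjectiveConnection

end

theorem mainTheorem3
    {E : Type u₁} [TopologicalSpace E] [T2Space E] [SecondCountableTopology E]
    [ChartedSpace Model3 E] [IsManifold I3 ∞ E]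
    {C : Type u₂} [TopologicalSpace C] [T2Space C] [SecondCountableTopology C]
    [ChartedSpace ℝ C] [IsManifold 𝓘(ℝ, ℝ) ∞ C] [ConnectedSpace C]
    (P : ProjectiveConnection E C) :
    -- some, and then every, developing map of the universal cover identifies it
    (P.IsComplete ↔ ∃ (U : ProjectiveConnection.UniversalCover.{0, 0, u₁, u₂} P)
      (D : U.conn.DevelopingMap), D.IdentifiesWithUniversalCover) ∧
    (∀ (U : ProjectiveConnection.UniversalCover.{u₃, u₄, u₁, u₂} P) (D : U.conn.DevelopingMap),
      P.IsComplete ↔ D.IdentifiesWithUniversalCover) ∧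
    (P.IsComplete ↔ P.IsElliptic ∨ P.IsClosedParabolicTwo ∨ P.IsClosedHyperbolicTwo) := by
  refine ⟨⟨fun h => ?_, fun ⟨U, D, hD⟩ => (U.isComplete_iff D).2 hD⟩,
    fun U D => U.isComplete_iff D, ProjectiveConnection.isComplete_iff_classification⟩
  obtain ⟨U, ⟨D⟩⟩ := h.exists_universalCover
  exact ⟨U, D, (U.isComplete_iff D).1 h⟩
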